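/- Let $\pi(y)$ denote the number of primes $p\le y$. For every real $\alpha$ with $0<\alpha<1$ there is a real number $x_0=x_0(\alpha)$ such that the following holds for all real $x\ge x_0$ and all real $\varepsilon\le 1$. If $$\pi(x+x^\alpha)-\pi(x)\ \ge\ (1-\varepsilon)\frac{x^\alpha}{\log x}\qquad\text{and}\qquad \pi(x)-\pi(x-x^\alpha)\ \ge\ (1-\varepsilon)\frac{x^\alpha}{\log x},$$ then the set $$E(x,\alpha)=\{P-Q:\ P,Q \text{ primes},\ x-x^\alpha<Q\le x<P\le x+x^\alpha\}$$ satisfies $$|E(x,\alpha)|\ \ge\ C_1\,\alpha^4(1-\varepsilon)^4\,x^\alpha,\qquad C_1=0.00164.$$ -/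

import Mathlib

/-- `primePi x` is the number of primes `p ≤ x`, for a real number `x`. -/
noncomputable def primePi (x : ℝ) : ℕ := Nat.primeCounting ⌊x⌋₊

/-- `primeDiffSet x α` is the set of all differences `P - Q` of primes `P`, `Q` with
`x - x ^ α < Q ≤ x < P ≤ x + x ^ α`. -/
def primeDiffSet (x α : ℝ) : Set ℤ :=
  {d : ℤ | ∃ P Q : ℕ, P.Prime ∧ Q.Prime ∧
    x - x ^ α < (Q : ℝ) ∧ (Q : ℝ) ≤ x ∧ x < (P : ℝ) ∧ (P : ℝ) ≤ x + x ^ α ∧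
    d = (P : ℤ) - (Q : ℤ)}

/-- The set of differences is finite, so `Set.ncard` is its true number of elements. -/
theorem primeDiffSet_finite (x α : ℝ) : (primeDiffSet x α).Finite := by
  refine (((Set.finite_Iic ⌊x + x ^ α⌋₊).prod (Set.finite_Iic ⌊x⌋₊)).image
    (fun p : ℕ × ℕ => (p.1 : ℤ) - (p.2 : ℤ))).subset ?_
  rintro d ⟨P, Q, -, -, -, hQ, -, hP, rfl⟩
  exact ⟨(P, Q), ⟨Nat.le_floor hP, Nat.le_floor hQ⟩, rfl⟩

open Finset

/-! Let A and B be the primes in the upper and lower interval, N ≈ x^α the interval length, and r(d)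
the number of ways to write d = P - Q. Cauchy–Schwarz gives (|A||B|)² ≤ |E| · ∑ r(d)², so it
suffices to bound the additive energy ∑ r(d)² above by 600 N³ / log⁴ N. With |A|, |B| at least (1-ε)
x^α / log x and log N ≥ α log x, this yields the factor α⁴(1-ε)⁴ x^α.

A coincidence P - Q = P' - Q' is the same as P' - P = Q' - Q = h
(`sq_card_mul_card_le_card_image_sub_mul`). The diagonal h = 0 is negligible, and odd h contribute
nothing. For even h > 0, Selberg's upper bound sieve (`card_sifted_le`, `card_prime_pairs_le`)
bounds the prime pairs with difference h in each interval by (N - h) S(h) / G plus an error, where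
S(h) is `singularFactor h`, the part of the twin prime singular series that depends on h, and G =
`twinSum z` ≥ log² z / 4 (`log_sq_div_four_le_twinSum`). The product of the two bounds is summed
over h with the mean square ∑ (N - h)² S(h)² ≤ (2/3) N³ (`sum_sub_sq_mul_singularFactor_sq_le`).
Taking z ≈ N^0.45 keeps the sieve error below the main term. -/

/-! ### Selberg's weights and their quadratic form. -/

theorem sum_powerset_neg_one_pow_card_superset (U V : Finset ℕ) :
    ∑ T ∈ U.powerset, (if V ⊆ T then (-1 : ℝ) ^ T.card else 0) =
      if U = V then (-1 : ℝ) ^ V.card else 0 := by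
  by_cases hVU : V ⊆ U
  -- Möbius inversion on subsets: expand the product over U of -1 + [p ∉ V]. A term survives only if
  -- T contains V, and the product vanishes as soon as U has an element outside V.
  · have h := Finset.prod_add (fun _ : ℕ => (-1 : ℝ)) (fun p => if p ∈ V then 0 else 1) U
    have h1 : ∀ T ∈ U.powerset, (∏ _i ∈ T, (-1 : ℝ)) * ∏ i ∈ U \ T, (if i ∈ V then (0 : ℝ) else 1)
        = if V ⊆ T then (-1 : ℝ) ^ T.card else 0 := by
      intro T _
      rw [Finset.prod_const]
      split_ifs with hVT
      · rw [Finset.prod_eq_one, mul_one]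
        intro i hi
        rw [if_neg]
        intro hiV
        exact (Finset.mem_sdiff.1 hi).2 (hVT hiV)
      · obtain ⟨i, hiV, hiT⟩ := Finset.not_subset.1 hVT
        rw [Finset.prod_eq_zero (i := i) (Finset.mem_sdiff.2 ⟨hVU hiV, hiT⟩) (by simp [hiV]),
          mul_zero]
    rw [Finset.sum_congr rfl h1] at h
    rw [← h]
    split_ifs with hUV
    · subst hUV
      rw [Finset.prod_congr rfl (g := fun _ => (-1 : ℝ)) (fun i hi => by simp [hi]),
        Finset.prod_const]
    · obtain ⟨i, hiU, hiV⟩ := Finset.not_subset.1 (fun h' => hUV (subset_antisymm h' hVU))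
      exact Finset.prod_eq_zero hiU (by simp [hiV])
  · rw [if_neg (fun h => hVU (by rw [h])), Finset.sum_eq_zero]
    intro T hT
    rw [if_neg (fun h => hVU (h.trans (Finset.mem_powerset.1 hT)))]

/-- The optimal weight of Selberg's upper bound sieve of density `ν`, for squarefree moduli
encoded as sets of primes in the family `D`. -/
noncomputable def selbergWeight (D : Finset (Finset ℕ)) (ν : ℕ → ℝ) (T : Finset ℕ) : ℝ :=
  (-1) ^ T.card * (∏ p ∈ T, ν p)⁻¹ *
    ((∑ U ∈ D, if T ⊆ U then ∏ p ∈ U, ν p / (1 - ν p) else 0) /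
      ∑ U ∈ D, ∏ p ∈ U, ν p / (1 - ν p))

section
variable {D : Finset (Finset ℕ)} {ν : ℕ → ℝ}

theorem sum_prod_odds_pos (h0 : ∅ ∈ D) (hν : ∀ U ∈ D, ∀ p ∈ U, 0 < ν p ∧ ν p < 1) :
    0 < ∑ U ∈ D, ∏ p ∈ U, ν p / (1 - ν p) := by
  refine Finset.sum_pos (fun U hU => Finset.prod_pos fun p hp => ?_) ⟨_, h0⟩
  have := hν U hU p hp
  exact div_pos this.1 (by linarith)

theorem selbergWeight_empty (h0 : ∅ ∈ D) (hν : ∀ U ∈ D, ∀ p ∈ U, 0 < ν p ∧ ν p < 1) :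
    selbergWeight D ν ∅ = 1 := by
  have := (sum_prod_odds_pos h0 hν).ne'
  simp only [selbergWeight, card_empty, pow_zero, prod_empty, inv_one, one_mul, empty_subset,
    if_true]
  exact div_self this

/-- These sums are the variables that diagonalise the quadratic form. After the sums over T and U
are swapped, Möbius inversion leaves only U = V; closure of D under subsets ensures that every T ⊆ U
occurs. -/
theorem sum_superset_selbergWeight (hD : ∀ U ∈ D, ∀ T ⊆ U, T ∈ D)
    (hν : ∀ U ∈ D, ∀ p ∈ U, 0 < ν p ∧ ν p < 1) {V : Finset ℕ} (hV : V ∈ D) :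
    ∑ T ∈ D, (if V ⊆ T then selbergWeight D ν T * ∏ p ∈ T, ν p else 0) =
      (-1) ^ V.card * (∏ p ∈ V, ν p / (1 - ν p)) / ∑ U ∈ D, ∏ p ∈ U, ν p / (1 - ν p) := by
  set G := ∑ U ∈ D, ∏ p ∈ U, ν p / (1 - ν p) with hG
  have h1 : ∀ T ∈ D, (if V ⊆ T then selbergWeight D ν T * ∏ p ∈ T, ν p else 0) =
      ∑ U ∈ D, (if T ⊆ U then (if V ⊆ T then (-1 : ℝ) ^ T.card else 0) else 0) *
        ((∏ p ∈ U, ν p / (1 - ν p)) / G) := by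
    intro T hT
    have hne : (∏ p ∈ T, ν p) ≠ 0 := (Finset.prod_pos fun p hp => (hν T hT p hp).1).ne'
    split_ifs with hVT
    · rw [selbergWeight, ← hG, Finset.sum_div, Finset.mul_sum, Finset.sum_mul]
      refine Finset.sum_congr rfl fun U _ => ?_
      split_ifs
      · field_simp
      · simp
    · simp
  rw [Finset.sum_congr rfl h1, Finset.sum_comm, Finset.sum_eq_single V]
  · rw [← Finset.sum_mul, ← Finset.sum_filter]
    have : D.filter (· ⊆ V) = V.powerset := by
      ext T
      simp only [Finset.mem_filter, Finset.mem_powerset]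
      exact ⟨fun h => h.2, fun h => ⟨hD V hV T h, h⟩⟩
    rw [this, sum_powerset_neg_one_pow_card_superset, if_pos rfl, mul_div_assoc]
  · intro U hU hUV
    rw [← Finset.sum_mul, ← Finset.sum_filter]
    have : D.filter (· ⊆ U) = U.powerset := by
      ext T
      simp only [Finset.mem_filter, Finset.mem_powerset]
      exact ⟨fun h => h.2, fun h => ⟨hD U hU T h, h⟩⟩
    rw [this, sum_powerset_neg_one_pow_card_superset, if_neg hUV, zero_mul]
  · exact fun h => absurd hV h

/-- Write ν(S ∪ T) = ν(S)ν(T)/ν(S ∩ T), and expand 1/ν(p) = 1 + 1/g(p) with g = ν/(1-ν). The form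
becomes ∑ y_V² / g(V) with y_V as in `sum_superset_selbergWeight`; since y_V = ±g(V)/G, it equals
1/G. -/
theorem selbergWeight_quadratic_form (h0 : ∅ ∈ D) (hD : ∀ U ∈ D, ∀ T ⊆ U, T ∈ D)
    (hν : ∀ U ∈ D, ∀ p ∈ U, 0 < ν p ∧ ν p < 1) :
    ∑ S ∈ D, ∑ T ∈ D, selbergWeight D ν S * selbergWeight D ν T * ∏ p ∈ S ∪ T, ν p =
      (∑ U ∈ D, ∏ p ∈ U, ν p / (1 - ν p))⁻¹ := by
  set G := ∑ U ∈ D, ∏ p ∈ U, ν p / (1 - ν p) with hG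
  have hG0 : 0 < G := sum_prod_odds_pos h0 hν
  have key : ∀ S ∈ D, ∀ T ∈ D, ∏ p ∈ S ∪ T, ν p = ∑ V ∈ D,
      (∏ p ∈ V, ν p / (1 - ν p))⁻¹ * ((if V ⊆ S then ∏ p ∈ S, ν p else 0) *
        (if V ⊆ T then ∏ p ∈ T, ν p else 0)) := by
    intro S hS T hT
    have hne : (∏ p ∈ S ∩ T, ν p) ≠ 0 := (Finset.prod_pos fun p hp =>
      (hν S hS p (Finset.mem_inter.1 hp).1).1).ne'
    have e1 : (∏ p ∈ S ∩ T, ν p)⁻¹ =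
        ∑ V ∈ (S ∩ T).powerset, (∏ p ∈ V, ν p / (1 - ν p))⁻¹ := by
      rw [← Finset.prod_inv_distrib]
      simp_rw [← Finset.prod_inv_distrib]
      rw [← Finset.prod_one_add]
      refine Finset.prod_congr rfl fun p hp => ?_
      have := hν S hS p (Finset.mem_inter.1 hp).1
      have h1 : 1 - ν p ≠ 0 := by linarith
      have h2 := this.1.ne'
      field_simp
      ring
    have e2 : ∏ p ∈ S ∪ T, ν p = (∏ p ∈ S, ν p) * (∏ p ∈ T, ν p) * (∏ p ∈ S ∩ T, ν p)⁻¹ := by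
      rw [← Finset.prod_union_inter, mul_assoc, mul_inv_cancel₀ hne, mul_one]
    have e3 : (S ∩ T).powerset = D.filter (fun V => V ⊆ S ∧ V ⊆ T) := by
      ext V
      simp only [Finset.mem_filter, Finset.mem_powerset, Finset.subset_inter_iff]
      exact ⟨fun h => ⟨hD S hS V h.1, h⟩, fun h => h.2⟩
    rw [e2, e1, e3, Finset.mul_sum, Finset.sum_filter]
    refine Finset.sum_congr rfl fun V _ => ?_
    by_cases h1 : V ⊆ S <;> by_cases h2 : V ⊆ T <;> (simp [h1, h2]; try ring)
  have step : ∑ S ∈ D, ∑ T ∈ D, selbergWeight D ν S * selbergWeight D ν T * ∏ p ∈ S ∪ T, ν p =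
      ∑ V ∈ D, (∏ p ∈ V, ν p / (1 - ν p))⁻¹ *
        (∑ T ∈ D, (if V ⊆ T then selbergWeight D ν T * ∏ p ∈ T, ν p else 0)) ^ 2 := by
    have : ∀ S ∈ D, ∀ T ∈ D, selbergWeight D ν S * selbergWeight D ν T * ∏ p ∈ S ∪ T, ν p =
        ∑ V ∈ D, (∏ p ∈ V, ν p / (1 - ν p))⁻¹ *
          ((if V ⊆ S then selbergWeight D ν S * ∏ p ∈ S, ν p else 0) *
          (if V ⊆ T then selbergWeight D ν T * ∏ p ∈ T, ν p else 0)) := by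
      intro S hS T hT
      rw [key S hS T hT, Finset.mul_sum]
      refine Finset.sum_congr rfl fun V _ => ?_
      split_ifs <;> ring
    rw [Finset.sum_congr rfl fun S hS => Finset.sum_congr rfl fun T hT => this S hS T hT]
    rw [Finset.sum_congr rfl fun S _ => Finset.sum_comm, Finset.sum_comm]
    refine Finset.sum_congr rfl fun V _ => ?_
    rw [sq, Finset.sum_mul_sum, Finset.mul_sum]
    refine Finset.sum_congr rfl fun S _ => ?_
    rw [Finset.mul_sum]
  rw [step]
  have : ∀ V ∈ D, (∏ p ∈ V, ν p / (1 - ν p))⁻¹ *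
      (∑ T ∈ D, (if V ⊆ T then selbergWeight D ν T * ∏ p ∈ T, ν p else 0)) ^ 2 =
      (∏ p ∈ V, ν p / (1 - ν p)) / G ^ 2 := by
    intro V hV
    have hne : (∏ p ∈ V, ν p / (1 - ν p)) ≠ 0 := (Finset.prod_pos fun p hp =>
      div_pos (hν V hV p hp).1 (by linarith [(hν V hV p hp).2])).ne'
    rw [sum_superset_selbergWeight hD hν hV, ← hG, div_pow, mul_pow, ← pow_mul, mul_comm V.card 2,
      pow_mul]
    generalize (∏ p ∈ V, ν p / (1 - ν p)) = w at *
    field_simp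
    norm_num
  rw [Finset.sum_congr rfl this, ← Finset.sum_div, ← hG]
  field_simp

/-- Each U ⊇ T splits into T and U \ T, and U \ T lies in D again, so the numerator of the weight is
at most g(T) G. Cruder than the classical bound 1, but it uses only closure under subsets. -/
theorem abs_selbergWeight_le (h0 : ∅ ∈ D) (hD : ∀ U ∈ D, ∀ T ⊆ U, T ∈ D)
    (hν : ∀ U ∈ D, ∀ p ∈ U, 0 < ν p ∧ ν p < 1) {T : Finset ℕ} (hT : T ∈ D) :
    |selbergWeight D ν T| ≤ ∏ p ∈ T, (1 - ν p)⁻¹ := by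
  set G := ∑ U ∈ D, ∏ p ∈ U, ν p / (1 - ν p) with hG
  have hG0 : 0 < G := sum_prod_odds_pos h0 hν
  have hodds : ∀ U ∈ D, ∀ p ∈ U, 0 < ν p / (1 - ν p) := fun U hU p hp =>
      div_pos (hν U hU p hp).1 (by linarith [(hν U hU p hp).2])
  have hT0 : 0 < ∏ p ∈ T, ν p := Finset.prod_pos fun p hp => (hν T hT p hp).1
  have hle : (∑ U ∈ D, if T ⊆ U then ∏ p ∈ U, ν p / (1 - ν p) else 0) ≤
      (∏ p ∈ T, ν p / (1 - ν p)) * G := by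
    rw [← Finset.sum_filter]
    have : ∀ U ∈ D.filter (T ⊆ ·), ∏ p ∈ U, ν p / (1 - ν p) =
        (∏ p ∈ T, ν p / (1 - ν p)) * ∏ p ∈ U \ T, ν p / (1 - ν p) := by
      intro U hU
      rw [mul_comm, Finset.prod_sdiff (Finset.mem_filter.1 hU).2]
    rw [Finset.sum_congr rfl this, ← Finset.mul_sum]
    refine mul_le_mul_of_nonneg_left ?_ (Finset.prod_nonneg fun p hp => (hodds T hT p hp).le)
    have hinj : Set.InjOn (fun U => U \ T) (D.filter (T ⊆ ·) : Finset (Finset ℕ)) := by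
      intro U hU W hW h
      simp only [Finset.coe_filter, Set.mem_ofPred_eq] at hU hW
      have h' : U \ T = W \ T := h
      rw [← Finset.sdiff_union_of_subset hU.2, h', Finset.sdiff_union_of_subset hW.2]
    rw [hG, ← Finset.sum_image (f := fun U => ∏ p ∈ U, ν p / (1 - ν p)) hinj]
    refine Finset.sum_le_sum_of_subset_of_nonneg ?_
      (fun U hU _ => Finset.prod_nonneg fun p hp => (hodds U hU p hp).le)
    intro W hW
    obtain ⟨U, hU, rfl⟩ := Finset.mem_image.1 hW
    exact hD U (Finset.mem_filter.1 hU).1 _ Finset.sdiff_subset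
  have hnn : 0 ≤ ∑ U ∈ D, if T ⊆ U then ∏ p ∈ U, ν p / (1 - ν p) else 0 := by
    refine Finset.sum_nonneg fun U hU => ?_
    split_ifs
    · exact Finset.prod_nonneg fun p hp => (hodds U hU p hp).le
    · exact le_rfl
  rw [selbergWeight, ← hG, abs_mul, abs_mul, abs_pow, abs_neg, abs_one, one_pow, one_mul,
    abs_of_pos (inv_pos.2 hT0), abs_of_nonneg (div_nonneg hnn hG0.le)]
  calc _ ≤ (∏ p ∈ T, ν p)⁻¹ * (∏ p ∈ T, ν p / (1 - ν p)) := by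
        refine mul_le_mul_of_nonneg_left ?_ (inv_pos.2 hT0).le
        rw [div_le_iff₀ hG0]
        exact hle
    _ = ∏ p ∈ T, (1 - ν p)⁻¹ := by
        rw [← Finset.prod_inv_distrib, ← Finset.prod_mul_distrib]
        refine Finset.prod_congr rfl fun p hp => ?_
        have := (hν T hT p hp).1.ne'
        field_simp

end

/-! ### Residue classes in an interval and the sieve inequality. -/

theorem abs_card_Ioc_filter_modEq_sub_le (a L c : ℕ) {M : ℕ} (hM : 0 < M) :
    |(#{n ∈ Ioc a (a + L) | n ≡ c [MOD M]} : ℝ) - L / M| ≤ 1 := by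
  have h := Nat.Ioc_filter_modEq_card a (a + L) hM c
  have hM' : (0 : ℝ) < M := by exact_mod_cast hM
  set u : ℚ := (((a + L : ℕ) : ℚ) - c) / M with hu
  set v : ℚ := ((a : ℚ) - c) / M with hv
  have huv : u - v = L / M := by
    rw [hu, hv]; push_cast; ring
  have hle : ⌊v⌋ ≤ ⌊u⌋ := by
    apply Int.floor_le_floor
    have : (0 : ℚ) ≤ L / M := by positivity
    linarith
  rw [max_eq_left (by linarith)] at h
  have h1 := Int.floor_le u
  have h2 := Int.lt_floor_add_one u
  have h3 := Int.floor_le v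
  have h4 := Int.lt_floor_add_one v
  have h5 : ((#{n ∈ Ioc a (a + L) | n ≡ c [MOD M]} : ℤ) : ℚ) = ⌊u⌋ - ⌊v⌋ := by
    rw [h]; push_cast; rfl
  have h6 : |((#{n ∈ Ioc a (a + L) | n ≡ c [MOD M]} : ℤ) : ℚ) - L / M| ≤ 1 := by
    rw [h5, abs_le]
    constructor <;> linarith
  have h7 := (Rat.cast_le (K := ℝ)).2 h6
  push_cast at h7
  exact h7

/-- The auxiliary class c mod M drives the induction: by the Chinese remainder theorem a new prime q
splits it into #(R q) classes mod M * q. Each final class costs an error of at most 1. -/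
theorem abs_card_Ioc_filter_residues_sub_le (a L : ℕ) (R : ℕ → Finset ℕ) (T : Finset ℕ)
    (hT : ∀ p ∈ T, p.Prime) (hR : ∀ p ∈ T, ∀ r ∈ R p, r < p) (M c : ℕ) (hM : 0 < M)
    (hMT : ∀ p ∈ T, M.Coprime p) :
    |(#{n ∈ Ioc a (a + L) | n ≡ c [MOD M] ∧ ∀ p ∈ T, n % p ∈ R p} : ℝ) -
      L * (∏ p ∈ T, (#(R p) / p : ℝ)) / M| ≤ ∏ p ∈ T, (#(R p) : ℝ) := by
  induction T using Finset.induction_on generalizing M c with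
  | empty =>
    simpa using abs_card_Ioc_filter_modEq_sub_le a L c hM
  | insert q T hq ih =>
    have hqp := hT q (mem_insert_self _ _)
    have hMq : M.Coprime q := hMT q (mem_insert_self _ _)
    have ih' := fun c' => ih (fun p hp => hT p (mem_insert_of_mem hp))
      (fun p hp => hR p (mem_insert_of_mem hp)) (M * q) c' (Nat.mul_pos hM hqp.pos)
      (fun p hp => Nat.Coprime.mul_left (hMT p (mem_insert_of_mem hp))
        ((Nat.coprime_primes hqp (hT p (mem_insert_of_mem hp))).2 (fun h => hq (h ▸ hp))))
    have hcard : #{n ∈ Ioc a (a + L) | n ≡ c [MOD M] ∧ ∀ p ∈ insert q T, n % p ∈ R p} =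
        ∑ r ∈ R q, #{n ∈ Ioc a (a + L) | n ≡ (Nat.chineseRemainder hMq c r : ℕ) [MOD M * q] ∧
          ∀ p ∈ T, n % p ∈ R p} := by
      rw [Finset.card_eq_sum_card_fiberwise (f := fun n => n % q) (t := R q)]
      · refine Finset.sum_congr rfl fun r hr => ?_
        congr 1
        ext n
        have hcr := (Nat.chineseRemainder hMq c r).2
        simp only [mem_filter, mem_insert, forall_eq_or_imp]
        rw [← Nat.modEq_and_modEq_iff_modEq_mul hMq]
        have hrq := hR q (mem_insert_self _ _) r hr
        constructor
        · rintro ⟨⟨h1, h2, h3, h4⟩, h5⟩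
          refine ⟨h1, ⟨h2.trans hcr.1.symm, Nat.ModEq.trans ?_ hcr.2.symm⟩, h4⟩
          rw [Nat.ModEq, h5, Nat.mod_eq_of_lt hrq]
        · rintro ⟨h1, ⟨h2, h3⟩, h4⟩
          have h5 : n % q = r := by
            have := h3.trans hcr.2
            rwa [Nat.ModEq, Nat.mod_eq_of_lt hrq] at this
          exact ⟨⟨h1, h2.trans hcr.1, h5 ▸ hr, h4⟩, h5⟩
      · intro n hn
        simp only [coe_filter, Set.mem_ofPred_eq, mem_insert, forall_eq_or_imp] at hn
        exact hn.2.2.1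
    rw [hcard, prod_insert hq, prod_insert hq]
    push_cast
    have e : (L : ℝ) * (#(R q) / q * ∏ p ∈ T, (#(R p) / p : ℝ)) / M =
        ∑ r ∈ R q, L * (∏ p ∈ T, (#(R p) / p : ℝ)) / ((M * q : ℕ) : ℝ) := by
      rw [sum_const, nsmul_eq_mul]
      push_cast
      have : (q : ℝ) ≠ 0 := by exact_mod_cast hqp.ne_zero
      have : (M : ℝ) ≠ 0 := by exact_mod_cast hM.ne'
      field_simp
    rw [e, ← sum_sub_distrib]
    refine (abs_sum_le_sum_abs _ _).trans ((sum_le_sum fun r _ => ih' _).trans ?_)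
    rw [sum_const, nsmul_eq_mul]

/-- Selberg's upper bound sieve for an interval, sifted by the residue classes `R p`. -/
theorem card_sifted_le (a L : ℕ) (R : ℕ → Finset ℕ) (P : Finset ℕ) (D : Finset (Finset ℕ))
    (hDP : ∀ T ∈ D, T ⊆ P) (h0 : ∅ ∈ D) (hD : ∀ U ∈ D, ∀ T ⊆ U, T ∈ D)
    (hP : ∀ p ∈ P, p.Prime) (hR : ∀ p ∈ P, ∀ r ∈ R p, r < p)
    (hρ : ∀ p ∈ P, 0 < #(R p) ∧ #(R p) < p) :
    (#{n ∈ Ioc a (a + L) | ∀ p ∈ P, n % p ∉ R p} : ℝ) ≤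
      L / (∑ T ∈ D, ∏ p ∈ T, (#(R p) / p : ℝ) / (1 - #(R p) / p)) +
      (∑ T ∈ D, ∏ p ∈ T, (#(R p) : ℝ) * (1 - #(R p) / p : ℝ)⁻¹) ^ 2 := by
  set ν : ℕ → ℝ := fun p => #(R p) / p with hνdef
  have hν : ∀ U ∈ D, ∀ p ∈ U, 0 < ν p ∧ ν p < 1 := by
    intro U hU p hp
    have h := hρ p (hDP U hU hp)
    have hp0 : (0 : ℝ) < p := by exact_mod_cast (hP p (hDP U hU hp)).pos
    refine ⟨div_pos (by exact_mod_cast h.1) hp0, ?_⟩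
    rw [hνdef, div_lt_one hp0]
    exact_mod_cast h.2
  set w := selbergWeight D ν with hw
  have hcount : ∀ S ∈ D, ∀ T ∈ D,
      |(#{n ∈ Ioc a (a + L) | ∀ p ∈ S ∪ T, n % p ∈ R p} : ℝ) - L * ∏ p ∈ S ∪ T, ν p| ≤
      ∏ p ∈ S ∪ T, (#(R p) : ℝ) := by
    intro S hS T hT
    have hsub : ∀ p ∈ S ∪ T, p ∈ P := fun p hp =>
      (mem_union.1 hp).elim (fun h => hDP S hS h) (fun h => hDP T hT h)
    have h := abs_card_Ioc_filter_residues_sub_le a L R (S ∪ T)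
      (fun p hp => hP p (hsub p hp)) (fun p hp => hR p (hsub p hp)) 1 0 one_pos (by simp)
    simp only [Nat.modEq_one, true_and, Nat.cast_one, div_one] at h
    exact h
  -- For an unsifted n only T = ∅ contributes, with weight 1; for any other n the square is
  -- nonnegative.
  have h1 : (#{n ∈ Ioc a (a + L) | ∀ p ∈ P, n % p ∉ R p} : ℝ) ≤
      ∑ n ∈ Ioc a (a + L), (∑ T ∈ D, if ∀ p ∈ T, n % p ∈ R p then w T else 0) ^ 2 := by
    rw [card_filter]
    push_cast
    refine sum_le_sum fun n _ => ?_
    split_ifs with hn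
    · rw [sum_eq_single ∅]
      · simp [hw, selbergWeight_empty h0 hν]
      · intro T hT hne
        obtain ⟨p, hp⟩ := nonempty_iff_ne_empty.2 hne
        exact if_neg fun h => hn p (hDP T hT hp) (h p hp)
      · exact fun h => absurd h0 h
    · positivity
  have h2 : ∑ n ∈ Ioc a (a + L), (∑ T ∈ D, if ∀ p ∈ T, n % p ∈ R p then w T else 0) ^ 2 =
      ∑ S ∈ D, ∑ T ∈ D, w S * w T * (#{n ∈ Ioc a (a + L) | ∀ p ∈ S ∪ T, n % p ∈ R p} : ℝ) := by
    simp_rw [sq, sum_mul_sum]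
    rw [sum_comm]
    refine sum_congr rfl fun S _ => ?_
    rw [sum_comm]
    refine sum_congr rfl fun T _ => ?_
    rw [card_filter]
    push_cast
    rw [mul_sum]
    refine sum_congr rfl fun n _ => ?_
    have : (∀ p ∈ S ∪ T, n % p ∈ R p) ↔ (∀ p ∈ S, n % p ∈ R p) ∧ (∀ p ∈ T, n % p ∈ R p) := by
      simp only [mem_union, or_imp, forall_and]
    by_cases hS : ∀ p ∈ S, n % p ∈ R p
    · by_cases hT : ∀ p ∈ T, n % p ∈ R p
      · rw [if_pos hS, if_pos hT, if_pos (this.2 ⟨hS, hT⟩), mul_one]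
      · rw [if_neg hT, if_neg (fun h => hT (this.1 h).2), mul_zero, mul_zero]
    · rw [if_neg hS, if_neg (fun h => hS (this.1 h).1), mul_zero, zero_mul]
  have h3 : ∀ S ∈ D, ∀ T ∈ D,
      w S * w T * (#{n ∈ Ioc a (a + L) | ∀ p ∈ S ∪ T, n % p ∈ R p} : ℝ) ≤
      L * (w S * w T * ∏ p ∈ S ∪ T, ν p) +
      (∏ p ∈ S, (#(R p) : ℝ) * (1 - ν p)⁻¹) * (∏ p ∈ T, (#(R p) : ℝ) * (1 - ν p)⁻¹) := by
    intro S hS T hT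
    have hc := hcount S hS T hT
    have hwS := abs_selbergWeight_le h0 hD hν hS
    have hwT := abs_selbergWeight_le h0 hD hν hT
    have hpos : ∀ U ∈ D, 0 ≤ ∏ p ∈ U, (1 - ν p)⁻¹ := fun U hU =>
      prod_nonneg fun p hp => inv_nonneg.2 (by linarith [(hν U hU p hp).2])
    -- Since #(R p) ≥ 1 on S ∩ T, the error factors over S and T, and the double sum of errors is a
    -- square.
    have hun : ∏ p ∈ S ∪ T, (#(R p) : ℝ) ≤ (∏ p ∈ S, (#(R p) : ℝ)) * ∏ p ∈ T, (#(R p) : ℝ) := by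
      rw [← prod_union_inter]
      refine le_mul_of_one_le_right (prod_nonneg fun p _ => by positivity) ?_
      have : (1 : ℕ) ≤ ∏ p ∈ S ∩ T, #(R p) := Nat.one_le_iff_ne_zero.2 (prod_ne_zero_iff.2
        fun p hp => (hρ p (hDP S hS (mem_inter.1 hp).1)).1.ne')
      exact_mod_cast this
    set X := (#{n ∈ Ioc a (a + L) | ∀ p ∈ S ∪ T, n % p ∈ R p} : ℝ)
    have : w S * w T * X - L * (w S * w T * ∏ p ∈ S ∪ T, ν p) ≤
        (∏ p ∈ S, (#(R p) : ℝ) * (1 - ν p)⁻¹) * (∏ p ∈ T, (#(R p) : ℝ) * (1 - ν p)⁻¹) := by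
      calc _ = w S * w T * (X - L * ∏ p ∈ S ∪ T, ν p) := by ring
        _ ≤ |w S * w T * (X - L * ∏ p ∈ S ∪ T, ν p)| := le_abs_self _
        _ = |w S| * |w T| * |X - L * ∏ p ∈ S ∪ T, ν p| := by rw [abs_mul, abs_mul]
        _ ≤ (∏ p ∈ S, (1 - ν p)⁻¹) * (∏ p ∈ T, (1 - ν p)⁻¹) *
            ((∏ p ∈ S, (#(R p) : ℝ)) * ∏ p ∈ T, (#(R p) : ℝ)) := by
          refine mul_le_mul (mul_le_mul hwS hwT (abs_nonneg _) (hpos S hS)) (hc.trans hun)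
            (abs_nonneg _) (mul_nonneg (hpos S hS) (hpos T hT))
        _ = _ := by rw [prod_mul_distrib, prod_mul_distrib]; ring
    linarith
  rw [h2] at h1
  refine h1.trans ((sum_le_sum fun S hS => sum_le_sum fun T hT => h3 S hS T hT).trans ?_)
  simp_rw [sum_add_distrib, ← mul_sum]
  have h4 := selbergWeight_quadratic_form h0 hD hν
  rw [← hw] at h4
  simp_rw [mul_sum] at h4 ⊢
  rw [sq, sum_mul_sum, div_eq_mul_inv, ← h4, mul_sum]
  simp_rw [mul_sum]
  exact le_rfl

/-! ### Lower bound log² z / 4 for the sieve denominator. -/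

/-- Sets of primes whose product is at most `z`: the squarefree numbers up to `z`. -/
def primeSets (z : ℕ) : Finset (Finset ℕ) :=
  {T ∈ ((range (z + 1)).filter Nat.Prime).powerset | ∏ p ∈ T, p ≤ z}

theorem mem_primeSets {z : ℕ} {T : Finset ℕ} :
    T ∈ primeSets z ↔ (∀ p ∈ T, p.Prime) ∧ ∏ p ∈ T, p ≤ z := by
  rw [primeSets, mem_filter, mem_powerset]
  refine ⟨fun h => ⟨fun p hp => (mem_filter.1 (h.1 hp)).2, h.2⟩, fun h => ⟨fun p hp => ?_, h.2⟩⟩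
  rw [mem_filter, mem_range]
  refine ⟨Nat.lt_succ_of_le (le_trans ?_ h.2), h.1 p hp⟩
  exact Nat.le_of_dvd (prod_pos fun q hq => (h.1 q hq).pos) (dvd_prod_of_mem _ hp)

theorem empty_mem_primeSets {z : ℕ} (hz : 1 ≤ z) : ∅ ∈ primeSets z :=
  mem_primeSets.2 ⟨by simp, by simpa using hz⟩

theorem primeSets_subset_closed {z : ℕ} :
    ∀ U ∈ primeSets z, ∀ T ⊆ U, T ∈ primeSets z := by
  intro U hU T hTU
  rw [mem_primeSets] at hU ⊢
  refine ⟨fun p hp => hU.1 p (hTU hp), le_trans ?_ hU.2⟩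
  exact Nat.le_of_dvd (prod_pos fun q hq => (hU.1 q hq).pos) (prod_dvd_prod_of_subset _ _ _ hTU)

/-- The completely multiplicative function with value `1 / 2` at `2` and `2 / p` at odd
primes `p`. -/
noncomputable def twinDensity : ℕ →* ℝ where
  toFun n := if n = 0 then 0 else
    (n.primeFactorsList.map fun p : ℕ => if p = 2 then (1 / 2 : ℝ) else 2 / p).prod
  map_one' := by simp
  map_mul' a b := by
    by_cases ha : a = 0
    · simp [ha]
    by_cases hb : b = 0
    · simp [hb]
    rw [if_neg ha, if_neg hb, if_neg (mul_ne_zero ha hb),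
      ((Nat.perm_primeFactorsList_mul ha hb).map _).prod_eq, List.map_append, List.prod_append]

theorem twinDensity_prime {p : ℕ} (hp : p.Prime) :
    twinDensity p = if p = 2 then (1 / 2 : ℝ) else 2 / p := by
  change (if p = 0 then (0 : ℝ) else _) = _
  rw [if_neg hp.ne_zero, Nat.primeFactorsList_prime hp]
  simp

theorem twinDensity_nonneg (n : ℕ) : 0 ≤ twinDensity n := by
  change 0 ≤ (if n = 0 then (0 : ℝ) else _)
  split_ifs
  · exact le_rfl
  · apply List.prod_nonneg
    intro a ha
    obtain ⟨p, _, rfl⟩ := List.mem_map.1 ha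
    split_ifs <;> positivity

theorem twinDensity_prime_bounds {p : ℕ} (hp : p.Prime) :
    0 < twinDensity p ∧ twinDensity p < 1 := by
  rw [twinDensity_prime hp]
  split_ifs with h
  · norm_num
  · have : (2 : ℝ) < p := by exact_mod_cast lt_of_le_of_ne hp.two_le (Ne.symm h)
    exact ⟨by positivity, (div_lt_one (by linarith)).2 this⟩

/-- A factor 2 leaves the odd divisors unchanged, while an odd prime at most doubles their number;
`twinDensity` has exactly these values over p. It reduces the denominator to a divisor sum. -/
theorem card_odd_divisors_le (n : ℕ) (hn : n ≠ 0) :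
    (#{d ∈ n.divisors | Odd d} : ℝ) / n ≤ twinDensity n := by
  induction n using induction_on_primes with
  | zero => exact absurd rfl hn
  | one => simp [filter_singleton]
  | prime_mul p a hp ih =>
    have ha : a ≠ 0 := right_ne_zero_of_mul hn
    have ih := ih ha
    have ha' : (0 : ℝ) < a := by exact_mod_cast Nat.pos_of_ne_zero ha
    have hp' : (0 : ℝ) < p := by exact_mod_cast hp.pos
    rw [map_mul, twinDensity_prime hp]
    rw [div_le_iff₀ ha'] at ih
    have hpa : (0 : ℝ) < ((p * a : ℕ) : ℝ) := by push_cast; positivity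
    rw [div_le_iff₀ hpa]
    push_cast
    split_ifs with h2
    · have hsub : {d ∈ (p * a).divisors | Odd d} ⊆ {d ∈ a.divisors | Odd d} := by
        intro d hd
        simp only [mem_filter, Nat.mem_divisors] at hd ⊢
        refine ⟨⟨?_, ha⟩, hd.2⟩
        refine Nat.Coprime.dvd_of_dvd_mul_left ?_ hd.1.1
        rw [h2]
        exact Nat.coprime_two_right.2 hd.2
      have := card_le_card hsub
      have h3 : (#{d ∈ (p * a).divisors | Odd d} : ℝ) ≤ #{d ∈ a.divisors | Odd d} := by
        exact_mod_cast this
      subst h2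
      push_cast
      linarith
    · have hsub : {d ∈ (p * a).divisors | Odd d} ⊆
          {d ∈ a.divisors | Odd d} ∪ {d ∈ a.divisors | Odd d}.image (p * ·) := by
        intro d hd
        simp only [mem_filter, Nat.mem_divisors, mem_union, mem_image] at hd ⊢
        by_cases hpd : p ∣ d
        · obtain ⟨e, rfl⟩ := hpd
          exact Or.inr ⟨e, ⟨⟨Nat.dvd_of_mul_dvd_mul_left hp.pos hd.1.1, ha⟩,
            (Nat.odd_mul.1 hd.2).2⟩, rfl⟩
        · exact Or.inl ⟨⟨Nat.Coprime.dvd_of_dvd_mul_left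
            ((Nat.Prime.coprime_iff_not_dvd hp).2 hpd).symm hd.1.1, ha⟩, hd.2⟩
      have h3 : #{d ∈ (p * a).divisors | Odd d} ≤ 2 * #{d ∈ a.divisors | Odd d} := by
        refine (card_le_card hsub).trans ((card_union_le _ _).trans ?_)
        have := card_image_le (s := {d ∈ a.divisors | Odd d}) (f := (p * ·))
        omega
      have h4 : (#{d ∈ (p * a).divisors | Odd d} : ℝ) ≤ 2 * #{d ∈ a.divisors | Odd d} := by
        exact_mod_cast h3
      have : (2 / p * twinDensity a * (p * a) : ℝ) = 2 * (twinDensity a * a) := by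
        field_simp
      rw [this]
      linarith

/-- The sifting odds at `p` for pairs of integers in general position. -/
noncomputable def twinOdds (p : ℕ) : ℝ := if p = 2 then 1 else 2 / (p - 2)

theorem twinOdds_eq {p : ℕ} (hp : p.Prime) :
    twinOdds p = twinDensity p * (1 - twinDensity p)⁻¹ := by
  rw [twinDensity_prime hp, twinOdds]
  split_ifs with h
  · norm_num
  · have h2 : (2 : ℝ) < p := by exact_mod_cast lt_of_le_of_ne hp.two_le (Ne.symm h)
    have h3 : (p : ℝ) - 2 ≠ 0 := by linarith
    have h4 : (p : ℝ) ≠ 0 := by linarith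
    have h5 : (1 : ℝ) - 2 / p ≠ 0 := by
      rw [one_sub_div h4]; positivity
    field_simp

/-- The denominator of Selberg's bound for pairs of primes up to `z`. -/
noncomputable def twinSum (z : ℕ) : ℝ := ∑ T ∈ primeSets z, ∏ p ∈ T, twinOdds p

/-- `twinOdds` is the geometric series of ν(p)^k over k ≥ 1. Each n in S is ∏ T times a number with
prime factors in T only, so the Euler product bounds the sum. -/
theorem sum_twinDensity_le_prod (S T : Finset ℕ) (hT : ∀ p ∈ T, p.Prime)
    (hS : ∀ n ∈ S, n ≠ 0 ∧ n.primeFactors = T) :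
    ∑ n ∈ S, twinDensity n ≤ ∏ p ∈ T, twinOdds p := by
  have hs := (EulerProduct.summable_and_hasSum_factoredNumbers_prod_filter_prime_geometric
    (f := twinDensity) (fun {p} hp => by
      rw [Real.norm_of_nonneg (twinDensity_nonneg p)]
      exact (twinDensity_prime_bounds hp).2) T).2
  rw [filter_true_of_mem hT] at hs
  have hs' := (hasSum_subtype_iff_indicator (f := fun n => twinDensity n)
    (s := Nat.factoredNumbers T)).1 hs
  have hdvd : ∀ n ∈ S, ∏ p ∈ T, p ∣ n := fun n hn => by
    rw [← (hS n hn).2]; exact Nat.prod_primeFactors_dvd n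
  have hpos : 0 < ∏ p ∈ T, p := prod_pos fun p hp => (hT p hp).pos
  have h1 : ∀ n ∈ S, twinDensity n = (∏ p ∈ T, twinDensity p) *
      (Nat.factoredNumbers T).indicator (fun n => twinDensity n) (n / ∏ p ∈ T, p) := by
    intro n hn
    have hmem : n / ∏ p ∈ T, p ∈ Nat.factoredNumbers T := by
      rw [Nat.mem_factoredNumbers_iff_primeFactors_subset]
      refine ⟨(Nat.div_pos (Nat.le_of_dvd (Nat.pos_of_ne_zero (hS n hn).1) (hdvd n hn)) hpos).ne',
        ?_⟩
      rw [← (hS n hn).2]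
      exact Nat.primeFactors_mono (by rw [(hS n hn).2]; exact Nat.div_dvd_of_dvd (hdvd n hn))
        (hS n hn).1
    rw [Set.indicator_of_mem hmem, ← map_prod, ← map_mul, Nat.mul_div_cancel' (hdvd n hn)]
  have hinj : Set.InjOn (fun n => n / ∏ p ∈ T, p) (S : Set ℕ) := by
    intro m hm n hn h
    have h' : m / ∏ p ∈ T, p = n / ∏ p ∈ T, p := h
    rw [← Nat.mul_div_cancel' (hdvd m hm), h', Nat.mul_div_cancel' (hdvd n hn)]
  rw [sum_congr rfl h1, ← mul_sum, prod_congr rfl fun p hp => twinOdds_eq (hT p hp),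
    prod_mul_distrib, ← sum_image (f := (Nat.factoredNumbers T).indicator fun n => twinDensity n)
      hinj]
  refine mul_le_mul_of_nonneg_left (sum_le_hasSum _ (fun n _ => ?_) hs')
    (prod_nonneg fun p _ => twinDensity_nonneg p)
  exact Set.indicator_nonneg (fun n _ => twinDensity_nonneg n) n

theorem sum_twinDensity_le_twinSum (z : ℕ) : ∑ n ∈ Icc 1 z, twinDensity n ≤ twinSum z := by
  rw [twinSum, ← sum_fiberwise_of_maps_to (s := Icc 1 z) (t := primeSets z)
    (g := fun n => n.primeFactors)]
  · refine sum_le_sum fun T hT => sum_twinDensity_le_prod _ _ (mem_primeSets.1 hT).1 fun n hn => ?_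
    rw [mem_filter, mem_Icc] at hn
    exact ⟨by omega, hn.2⟩
  · intro n hn
    rw [mem_Icc] at hn
    exact mem_primeSets.2 ⟨fun p hp => Nat.prime_of_mem_primeFactors hp,
      (Nat.le_of_dvd (by omega) (Nat.prod_primeFactors_dvd n)).trans hn.2⟩

theorem log_le_sum_inv_odd (K : ℕ) :
    Real.log (2 * K + 1) / 2 ≤ ∑ k ∈ range K, 1 / (2 * (k : ℝ) + 1) := by
  induction K with
  | zero => simp
  | succ K ih =>
    rw [sum_range_succ]
    have h1 : (0 : ℝ) < 2 * K + 1 := by positivity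
    have h2 : Real.log ((2 * (K + 1 : ℕ) + 1) / (2 * K + 1)) ≤ 2 / (2 * K + 1) := by
      refine (Real.log_le_sub_one_of_pos (by positivity)).trans (le_of_eq ?_)
      push_cast
      field_simp
      ring
    rw [Real.log_div (by positivity) (by positivity)] at h2
    have : (2 : ℝ) / (2 * K + 1) = 2 * (1 / (2 * K + 1)) := by ring
    linarith

/-- The left side is the integral of log(z/t)/t over [1, m+1], and the integrand decreases there;
the induction compares increments. -/
theorem log_sq_le_sum_log_div (z m : ℕ) (hm : m + 1 ≤ z) :
    (Real.log z ^ 2 - Real.log (z / (m + 1)) ^ 2) / 2 ≤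
      ∑ a ∈ Icc 1 m, 1 / (a : ℝ) * Real.log (z / a) := by
  induction m with
  | zero => simp
  | succ m ih =>
    rw [sum_Icc_succ_top (by omega)]
    have ih := ih (by omega)
    have hz : ((m : ℝ) + 1 + 1) ≤ z := by exact_mod_cast hm
    have hm0 : (0 : ℝ) < (m : ℝ) + 1 := by positivity
    have hz0 : (0 : ℝ) < z := by linarith
    have h2 : Real.log (((m : ℝ) + 1 + 1) / (m + 1)) ≤ 1 / (m + 1) := by
      refine (Real.log_le_sub_one_of_pos (by positivity)).trans (le_of_eq ?_)
      field_simp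
      ring
    have h4 : 0 ≤ Real.log ((z : ℝ) / (m + 1 + 1)) :=
      Real.log_nonneg ((one_le_div (by positivity)).2 hz)
    have h5 : Real.log ((z : ℝ) / (m + 1)) =
        Real.log ((z : ℝ) / (m + 1 + 1)) + Real.log (((m : ℝ) + 1 + 1) / (m + 1)) := by
      rw [← Real.log_mul (by positivity) (by positivity)]
      congr 1
      field_simp
    have h6 : 0 ≤ Real.log (((m : ℝ) + 1 + 1) / (m + 1)) :=
      Real.log_nonneg ((one_le_div hm0).2 (by linarith))
    push_cast
    rw [h5] at ih ⊢
    generalize Real.log ((z : ℝ) / (m + 1 + 1)) = u at *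
    generalize Real.log (((m : ℝ) + 1 + 1) / (m + 1)) = v at *
    have : v * (u + v) ≤ 1 / ((m : ℝ) + 1) * (u + v) :=
      mul_le_mul_of_nonneg_right h2 (by linarith)
    nlinarith

/-- Parametrise n = a(2k+1) by the odd divisor 2k+1; there are (z / a + 1) / 2 odd numbers up to z /
a. -/
theorem sum_card_odd_divisors_ge (z : ℕ) :
    ∑ a ∈ Icc 1 z, ∑ k ∈ range ((z / a + 1) / 2), 1 / (a : ℝ) * (1 / (2 * (k : ℝ) + 1)) ≤
      ∑ n ∈ Icc 1 z, (#{d ∈ n.divisors | Odd d} : ℝ) / n := by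
  have h1 : ∀ n ∈ Icc 1 z, (#{d ∈ n.divisors | Odd d} : ℝ) / n =
      ∑ d ∈ n.divisors with Odd d, 1 / (n : ℝ) := by
    intro n _
    rw [sum_const, nsmul_eq_mul, mul_one_div]
  rw [sum_congr rfl h1, sum_sigma', sum_sigma']
  have hmem : ∀ x ∈ (Icc 1 z).sigma (fun a => range ((z / a + 1) / 2)),
      1 ≤ x.1 ∧ x.1 * (2 * x.2 + 1) ≤ z := by
    rintro ⟨a, k⟩ hx
    simp only [mem_sigma, mem_Icc, mem_range] at hx ⊢
    refine ⟨hx.1.1, ?_⟩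
    have : 2 * k + 1 ≤ z / a := by omega
    rw [mul_comm]
    exact (Nat.le_div_iff_mul_le (by omega)).1 this
  set e : (Σ _ : ℕ, ℕ) → (Σ _ : ℕ, ℕ) := fun x => ⟨x.1 * (2 * x.2 + 1), 2 * x.2 + 1⟩ with he
  have hinj : Set.InjOn e ((Icc 1 z).sigma (fun a => range ((z / a + 1) / 2)) : Set _) := by
    rintro ⟨a, k⟩ _ ⟨b, l⟩ _ h
    simp only [he, Sigma.mk.injEq, heq_eq_eq] at h
    have hkl : k = l := by omega
    subst hkl
    have := Nat.eq_of_mul_eq_mul_right (by omega) h.1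
    simp [this]
  have h2 : ∀ x ∈ (Icc 1 z).sigma (fun a => range ((z / a + 1) / 2)),
      1 / (x.1 : ℝ) * (1 / (2 * (x.2 : ℝ) + 1)) = (fun y : Σ _ : ℕ, ℕ => 1 / (y.1 : ℝ)) (e x) := by
    rintro ⟨a, k⟩ _
    simp only [he]
    push_cast
    rw [div_mul_div_comm, one_mul]
  rw [sum_congr rfl h2, ← sum_image (f := fun y : Σ _ : ℕ, ℕ => 1 / (y.1 : ℝ)) hinj]
  refine sum_le_sum_of_subset_of_nonneg ?_ (fun y _ _ => by positivity)
  intro y hy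
  obtain ⟨⟨a, k⟩, hx, rfl⟩ := mem_image.1 hy
  have := hmem _ hx
  simp only [he, mem_sigma, mem_Icc, mem_filter, Nat.mem_divisors] at this ⊢
  have hpos : 0 < a * (2 * k + 1) := Nat.mul_pos (by omega) (by omega)
  exact ⟨⟨hpos, this.2⟩, ⟨⟨Dvd.intro_left _ rfl, hpos.ne'⟩, ⟨k, rfl⟩⟩⟩

theorem log_sq_div_four_le_twinSum (z : ℕ) (hz : 1 ≤ z) : Real.log z ^ 2 / 4 ≤ twinSum z := by
  refine le_trans ?_ (sum_twinDensity_le_twinSum z)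
  refine le_trans ?_ (sum_le_sum fun n hn => card_odd_divisors_le n (by
    rw [mem_Icc] at hn; omega))
  refine le_trans ?_ (sum_card_odd_divisors_ge z)
  have h1 : ∀ a ∈ Icc 1 z, 1 / (a : ℝ) * Real.log (z / a) / 2 ≤
      ∑ k ∈ range ((z / a + 1) / 2), 1 / (a : ℝ) * (1 / (2 * (k : ℝ) + 1)) := by
    intro a ha
    rw [mem_Icc] at ha
    have ha0 : (0 : ℝ) < a := by exact_mod_cast ha.1
    rw [← mul_sum, mul_div_assoc]
    refine mul_le_mul_of_nonneg_left (le_trans ?_ (log_le_sum_inv_odd _)) (by positivity)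
    have hz0 : (0 : ℝ) < z := by exact_mod_cast hz
    refine div_le_div_of_nonneg_right (Real.log_le_log (by positivity) ?_) (by norm_num)
    rw [div_le_iff₀ ha0]
    have h2 : z < (2 * ((z / a + 1) / 2) + 1) * a := by
      have := Nat.lt_mul_div_succ z ha.1
      calc z < a * (z / a + 1) := this
        _ ≤ (2 * ((z / a + 1) / 2) + 1) * a := by
          rw [mul_comm]
          exact Nat.mul_le_mul_right _ (by omega)
    exact_mod_cast h2.le
  refine le_trans ?_ (sum_le_sum h1)
  rw [← sum_div]
  -- The term a = z vanishes, and with m = z - 1 so does the subtracted square, leaving all of log²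
  -- z / 2.
  obtain ⟨m, rfl⟩ : ∃ m, z = m + 1 := ⟨z - 1, by omega⟩
  have h3 := log_sq_le_sum_log_div (m + 1) m le_rfl
  have hm : ((m + 1 : ℕ) : ℝ) ≠ 0 := by positivity
  rw [sum_Icc_succ_top (by omega), div_self hm, Real.log_one, mul_zero, add_zero]
  have h4 : ((m + 1 : ℕ) : ℝ) / (m + 1) = 1 := by
    push_cast at hm ⊢
    exact div_self hm
  rw [h4, Real.log_one] at h3
  linarith

/-! ### Dependence of the sieve denominator on the difference h. -/

theorem sum_prod_le_of_eq_off_singleton {D : Finset (Finset ℕ)}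
    (hD : ∀ U ∈ D, ∀ T ⊆ U, T ∈ D) {g g' : ℕ → ℝ} {q : ℕ} {t : ℝ} (ht : 0 ≤ t)
    (hg : ∀ U ∈ D, ∀ p ∈ U, 0 ≤ g p) (hne : ∀ p, p ≠ q → g' p = g p)
    (hq : g' q = g q + t + g q * t) :
    ∑ T ∈ D, ∏ p ∈ T, g' p ≤ (1 + t) * ∑ T ∈ D, ∏ p ∈ T, g p := by
  have hnn : ∀ U ∈ D, 0 ≤ ∏ p ∈ U, g p := fun U hU => prod_nonneg fun p hp => hg U hU p hp
  -- The hypothesis `hq` says 1 + g'(q) = (1 + t)(1 + g(q)). The excess of a set T containing q is t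
  -- times the terms of T \ {q} and T, and distinct T give distinct T \ {q} in D.
  have h1 : ∀ T ∈ D, ∏ p ∈ T, g' p = ∏ p ∈ T, g p +
      t * (if q ∈ T then ∏ p ∈ T.erase q, g p + ∏ p ∈ T, g p else 0) := by
    intro T _
    split_ifs with hqT
    · rw [← mul_prod_erase T g' hqT, ← mul_prod_erase T g hqT, hq,
        prod_congr rfl fun p hp => hne p (ne_of_mem_erase hp)]
      ring
    · rw [mul_zero, add_zero]
      exact prod_congr rfl fun p hp => hne p fun h => hqT (h ▸ hp)
  rw [sum_congr rfl h1, sum_add_distrib, ← mul_sum, one_add_mul]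
  refine add_le_add le_rfl (mul_le_mul_of_nonneg_left ?_ ht)
  rw [← sum_filter, sum_add_distrib, ← sum_filter_add_sum_filter_not D (q ∈ ·), add_comm]
  refine add_le_add le_rfl ?_
  have hinj : Set.InjOn (fun T : Finset ℕ => T.erase q) (D.filter (q ∈ ·) : Finset (Finset ℕ)) := by
    intro S hS T hT h
    rw [mem_coe, mem_filter] at hS hT
    rw [← insert_erase hS.2, ← insert_erase hT.2]
    exact congrArg _ h
  rw [← sum_image (f := fun T => ∏ p ∈ T, g p) hinj]
  refine sum_le_sum_of_subset_of_nonneg ?_ fun U hU _ => hnn U (mem_filter.1 hU).1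
  intro U hU
  obtain ⟨T, hT, rfl⟩ := mem_image.1 hU
  rw [mem_filter] at hT ⊢
  exact ⟨hD T hT.1 _ (erase_subset _ _), notMem_erase _ _⟩

theorem sum_prod_le_prod_mul_sum_prod {D : Finset (Finset ℕ)}
    (hD : ∀ U ∈ D, ∀ T ⊆ U, T ∈ D) {g g' t : ℕ → ℝ} (S : Finset ℕ) (ht : ∀ p ∈ S, 0 ≤ t p)
    (hg : ∀ U ∈ D, ∀ p ∈ U, 0 ≤ g p) (hne : ∀ U ∈ D, ∀ p ∈ U, p ∉ S → g' p = g p)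
    (hq : ∀ p ∈ S, g' p = g p + t p + g p * t p) :
    ∑ T ∈ D, ∏ p ∈ T, g' p ≤ (∏ p ∈ S, (1 + t p)) * ∑ T ∈ D, ∏ p ∈ T, g p := by
  induction S using Finset.induction_on generalizing g' with
  | empty =>
    rw [prod_empty, one_mul]
    exact (sum_congr rfl fun U hU => prod_congr rfl fun p hp => hne U hU p hp (by simp)).le
  | insert q S hqS ih =>
    have htq := ht q (mem_insert_self _ _)
    have ih := ih (g' := Function.update g' q (g q)) (fun p hp => ht p (mem_insert_of_mem hp))
      (fun U hU p hp hpS => by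
        by_cases hpq : p = q
        · subst hpq; simp
        · rw [Function.update_of_ne hpq]
          exact hne U hU p hp (by simp [hpq, hpS]))
      (fun p hp => by
        rw [Function.update_of_ne (ne_of_mem_of_not_mem hp hqS)]
        exact hq p (mem_insert_of_mem hp))
    rw [prod_insert hqS, mul_assoc]
    refine le_trans ?_ (mul_le_mul_of_nonneg_left ih (by linarith))
    refine sum_prod_le_of_eq_off_singleton hD htq (q := q) (fun U hU p hp => ?_)
      (fun p hp => by rw [Function.update_of_ne hp]) (by
        rw [Function.update_self]; exact hq q (mem_insert_self _ _))
    by_cases hpq : p = q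
    · subst hpq; simpa using hg U hU p hp
    · rw [Function.update_of_ne hpq]
      by_cases hpS : p ∈ S
      · rw [hq p (mem_insert_of_mem hpS)]
        have h1 := hg U hU p hp
        have h2 := ht p (mem_insert_of_mem hpS)
        positivity
      · rw [hne U hU p hp (by simp [hpq, hpS])]
        exact hg U hU p hp

/-- The residues `r` modulo `p` with `p ∣ r * (r + h)`. -/
def pairResidues (h p : ℕ) : Finset ℕ := {0, (p - h % p) % p}

theorem lt_of_mem_pairResidues {h p r : ℕ} (hp : 0 < p) (hr : r ∈ pairResidues h p) : r < p := by
  simp only [pairResidues, mem_insert, mem_singleton] at hr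
  rcases hr with rfl | rfl
  · exact hp
  · exact Nat.mod_lt _ hp

theorem card_pairResidues_of_dvd {h p : ℕ} (hp : p ∣ h) : #(pairResidues h p) = 1 := by
  simp [pairResidues, Nat.mod_eq_zero_of_dvd hp]

theorem card_pairResidues_of_not_dvd {h p : ℕ} (hp0 : 0 < p) (hp : ¬ p ∣ h) :
    #(pairResidues h p) = 2 := by
  apply card_pair
  have h1 : 0 < h % p := Nat.pos_of_ne_zero fun h' => hp (Nat.dvd_of_mod_eq_zero h')
  have h2 : h % p < p := Nat.mod_lt _ hp0
  rw [Nat.mod_eq_of_lt (by omega)]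
  omega

theorem dvd_or_dvd_of_mod_mem_pairResidues {h p n : ℕ} (hp : 0 < p)
    (hn : n % p ∈ pairResidues h p) : p ∣ n ∨ p ∣ n + h := by
  simp only [pairResidues, mem_insert, mem_singleton] at hn
  rcases hn with hn | hn
  · exact Or.inl (Nat.dvd_of_mod_eq_zero hn)
  · right
    apply Nat.dvd_of_mod_eq_zero
    have h2 : h % p < p := Nat.mod_lt _ hp
    rw [Nat.add_mod, hn, ← Nat.add_mod, Nat.add_mod (p - h % p) h p, Nat.add_mod,
      Nat.mod_mod, Nat.mod_mod]
    rw [Nat.mod_add_mod]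
    rw [Nat.sub_add_cancel h2.le, Nat.mod_self]

/-- The factor `∏ (p - 1) / (p - 2)` over odd primes `p ∣ h` of the twin prime singular series. -/
noncomputable def singularFactor (h : ℕ) : ℝ :=
  ∏ p ∈ h.primeFactors.erase 2, (1 + 1 / ((p : ℝ) - 2))

theorem two_lt_of_mem_erase {h p : ℕ} (hp : p ∈ h.primeFactors.erase 2) : (2 : ℝ) < p := by
  rw [mem_erase] at hp
  exact_mod_cast lt_of_le_of_ne (Nat.prime_of_mem_primeFactors hp.2).two_le (Ne.symm hp.1)

/-- An odd p dividing h removes one class instead of two, so one plus the odds drops from p/(p-2) to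
p/(p-1). The ratio is the factor 1 + 1/(p-2) of `singularFactor`. -/
theorem twinSum_le_singularFactor_mul {h z : ℕ} (hh : h ≠ 0) (h2 : Even h) :
    twinSum z ≤ singularFactor h * ∑ T ∈ primeSets z,
      ∏ p ∈ T, (#(pairResidues h p) / p : ℝ) / (1 - #(pairResidues h p) / p) := by
  refine sum_prod_le_prod_mul_sum_prod primeSets_subset_closed _ (fun p hp => ?_)
    (fun U hU p hp => ?_) (fun U hU p hp hpS => ?_) (fun p hp => ?_)
  · have := two_lt_of_mem_erase hp
    have : 0 < (p : ℝ) - 2 := by linarith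
    positivity
  · have hpp := (mem_primeSets.1 hU).1 p hp
    have hp0 : (0 : ℝ) < p := by exact_mod_cast hpp.pos
    have hle : (#(pairResidues h p) : ℝ) ≤ 2 := by exact_mod_cast card_le_two
    have h2p : (2 : ℝ) ≤ p := by exact_mod_cast hpp.two_le
    refine div_nonneg (by positivity) ?_
    rw [sub_nonneg, div_le_one hp0]
    linarith
  · have hpp := (mem_primeSets.1 hU).1 p hp
    by_cases hp2 : p = 2
    · subst hp2
      rw [card_pairResidues_of_dvd h2.two_dvd, twinOdds, if_pos rfl]
      norm_num
    · have hnd : ¬ p ∣ h := fun hd =>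
        hpS (mem_erase.2 ⟨hp2, Nat.mem_primeFactors.2 ⟨hpp, hd, hh⟩⟩)
      have h3 : (2 : ℝ) < p := by exact_mod_cast lt_of_le_of_ne hpp.two_le (Ne.symm hp2)
      rw [card_pairResidues_of_not_dvd hpp.pos hnd, twinOdds, if_neg hp2]
      have h4 : (p : ℝ) - 2 ≠ 0 := by linarith
      have h5 : (p : ℝ) ≠ 0 := by linarith
      push_cast
      rw [one_sub_div h5]
      field_simp
  · have h3 := two_lt_of_mem_erase hp
    rw [mem_erase] at hp
    rw [card_pairResidues_of_dvd (Nat.dvd_of_mem_primeFactors hp.2), twinOdds, if_neg hp.1]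
    have h4 : (p : ℝ) - 2 ≠ 0 := by linarith
    have h5 : (p : ℝ) ≠ 0 := by linarith
    have h6 : (p : ℝ) - 1 ≠ 0 := by linarith
    push_cast
    rw [one_sub_div h5]
    field_simp
    ring

theorem card_pairResidues_bounds {h p : ℕ} (h2 : Even h) (hp : p.Prime) :
    0 < #(pairResidues h p) ∧ #(pairResidues h p) < p := by
  by_cases hd : p ∣ h
  · rw [card_pairResidues_of_dvd hd]
    exact ⟨one_pos, hp.one_lt⟩
  · rw [card_pairResidues_of_not_dvd hp.pos hd]
    refine ⟨two_pos, lt_of_le_of_ne hp.two_le ?_⟩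
    rintro rfl
    exact hd h2.two_dvd

/-- The extreme case is p = 3 with two classes, 2 / (1 - 2/3) = 6. -/
theorem card_pairResidues_mul_inv_le {h p : ℕ} (h2 : Even h) (hp : p.Prime) :
    (#(pairResidues h p) : ℝ) * (1 - #(pairResidues h p) / p : ℝ)⁻¹ ≤ 6 := by
  have hb := (card_pairResidues_bounds h2 hp).2
  have hp0 : (0 : ℝ) < p := by exact_mod_cast hp.pos
  have hle : #(pairResidues h p) ≤ 2 := card_le_two
  have hb' : (#(pairResidues h p) : ℝ) < p := by exact_mod_cast hb
  rw [← div_eq_mul_inv, one_sub_div hp0.ne', div_div_eq_mul_div, div_le_iff₀ (by linarith)]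
  have h3 : #(pairResidues h p) * p ≤ 6 * (p - #(pairResidues h p)) := by
    interval_cases #(pairResidues h p) <;> omega
  have h4 : (#(pairResidues h p) : ℝ) * p ≤ 6 * ((p - #(pairResidues h p) : ℕ) : ℝ) := by
    exact_mod_cast h3
  rwa [Nat.cast_sub hb.le] at h4

/-- Selberg's bound for the number of prime pairs with even difference `h` in an interval. -/
theorem card_prime_pairs_le {a L h z : ℕ} (hz : 1 ≤ z) (ha : z ≤ a) (hh : h ≠ 0) (h2 : Even h) :
    (#{q ∈ Ioc a (a + L) | q.Prime ∧ (q + h).Prime} : ℝ) ≤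
      L * singularFactor h / twinSum z + (∑ T ∈ primeSets z, (6 : ℝ) ^ #T) ^ 2 := by
  have h0 := empty_mem_primeSets hz
  set P := (range (z + 1)).filter Nat.Prime with hPdef
  have hP : ∀ p ∈ P, p.Prime := fun p hp => (mem_filter.1 hp).2
  have key := card_sifted_le a L (pairResidues h) P (primeSets z)
    (fun T hT p hp => (mem_powerset.1 (mem_filter.1 hT).1) hp) h0 primeSets_subset_closed hP
    (fun p hp r hr => lt_of_mem_pairResidues (hP p hp).pos hr)
    (fun p hp => card_pairResidues_bounds h2 (hP p hp))
  have hsub : {q ∈ Ioc a (a + L) | q.Prime ∧ (q + h).Prime} ⊆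
      {n ∈ Ioc a (a + L) | ∀ p ∈ P, n % p ∉ pairResidues h p} := by
    intro q hq
    rw [mem_filter, mem_Ioc] at hq
    rw [mem_filter, mem_Ioc]
    refine ⟨hq.1, fun p hp hmem => ?_⟩
    -- As q > a ≥ z, a prime p ≤ z can equal neither q nor q + h.
    have hpz : p ≤ z := Nat.lt_succ_iff.1 (mem_range.1 (mem_filter.1 hp).1)
    rcases dvd_or_dvd_of_mod_mem_pairResidues (hP p hp).pos hmem with hd | hd
    · have := (Nat.prime_dvd_prime_iff_eq (hP p hp) hq.2.1).1 hd
      omega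
    · have := (Nat.prime_dvd_prime_iff_eq (hP p hp) hq.2.2).1 hd
      omega
  have h1 : (#{q ∈ Ioc a (a + L) | q.Prime ∧ (q + h).Prime} : ℝ) ≤
      #{n ∈ Ioc a (a + L) | ∀ p ∈ P, n % p ∉ pairResidues h p} := by
    exact_mod_cast card_le_card hsub
  refine h1.trans (key.trans (add_le_add ?_ ?_))
  · set G := ∑ T ∈ primeSets z,
      ∏ p ∈ T, (#(pairResidues h p) / p : ℝ) / (1 - #(pairResidues h p) / p) with hG
    have hG0 : 0 < G := by
      refine sum_prod_odds_pos h0 fun U hU p hp => ?_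
      have hpp := (mem_primeSets.1 hU).1 p hp
      have hb := card_pairResidues_bounds h2 hpp
      have hp0 : (0 : ℝ) < p := by exact_mod_cast hpp.pos
      exact ⟨div_pos (by exact_mod_cast hb.1) hp0, (div_lt_one hp0).2 (by exact_mod_cast hb.2)⟩
    have hW : 0 < twinSum z := by
      refine sum_pos (fun U hU => prod_pos fun p hp => ?_) ⟨_, h0⟩
      have hpp := (mem_primeSets.1 hU).1 p hp
      have hb := twinDensity_prime_bounds hpp
      rw [twinOdds_eq hpp]
      exact mul_pos hb.1 (inv_pos.2 (by linarith))
    rw [div_le_div_iff₀ hG0 hW, mul_assoc]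
    exact mul_le_mul_of_nonneg_left (twinSum_le_singularFactor_mul hh h2) (by positivity)
  · have hpos : ∀ T ∈ primeSets z, ∀ p ∈ T,
        0 ≤ (#(pairResidues h p) : ℝ) * (1 - #(pairResidues h p) / p : ℝ)⁻¹ := by
      intro T hT p hp
      have hpp := (mem_primeSets.1 hT).1 p hp
      have hlt := (card_pairResidues_bounds h2 hpp).2
      have hp0 : (0 : ℝ) < p := by exact_mod_cast hpp.pos
      have : (#(pairResidues h p) / p : ℝ) ≤ 1 := (div_le_one hp0).2 (by exact_mod_cast hlt.le)
      exact mul_nonneg (by positivity) (inv_nonneg.2 (by linarith))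
    refine pow_le_pow_left₀ (sum_nonneg fun T hT => prod_nonneg (hpos T hT)) ?_ 2
    refine sum_le_sum fun T hT => ?_
    rw [← prod_const]
    exact prod_le_prod (hpos T hT) fun p hp =>
      card_pairResidues_mul_inv_le h2 ((mem_primeSets.1 hT).1 p hp)

/-! ### The error term of the sieve. -/

theorem exists_pow_card_le_mul_rpow (B : ℝ) (hB : 1 ≤ B) (δ : ℝ) (hδ : 0 < δ) :
    ∃ C : ℝ, 0 < C ∧ ∀ T : Finset ℕ, (∀ p ∈ T, p.Prime) →
      B ^ #T ≤ C * ((∏ p ∈ T, p : ℕ) : ℝ) ^ δ := by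
  obtain ⟨K, hK⟩ := ((tendsto_rpow_atTop hδ).comp
    tendsto_natCast_atTop_atTop).eventually_ge_atTop B |>.exists_forall_of_atTop
  -- Primes p ≥ K satisfy p^δ ≥ B and pay for themselves; fewer than K + 1 primes remain.
  refine ⟨B ^ K, by positivity, fun T hT => ?_⟩
  have h1 : ∏ p ∈ T, B ≤ ∏ p ∈ T, ((if p < K then B else 1) * (p : ℝ) ^ δ) := by
    refine prod_le_prod (fun p _ => by linarith) fun p hp => ?_
    have hp1 : (1 : ℝ) ≤ p := by exact_mod_cast (hT p hp).one_lt.le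
    split_ifs with h
    · exact le_mul_of_one_le_right (by linarith) (Real.one_le_rpow hp1 hδ.le)
    · rw [one_mul]; exact hK p (by omega)
  rw [prod_const, prod_mul_distrib, Real.finsetProd_rpow _ _ (fun p _ => by positivity)] at h1
  push_cast
  refine h1.trans (mul_le_mul_of_nonneg_right ?_ (by positivity))
  rw [prod_ite, prod_const_one, mul_one, prod_const]
  refine pow_le_pow_right₀ hB ?_
  refine (card_le_card (t := range K) fun p hp => ?_).trans (card_range K).le
  exact mem_range.2 (mem_filter.1 hp).2

theorem card_primeSets_le (z : ℕ) : #(primeSets z) ≤ z := by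
  refine (card_le_card_of_injOn (t := Icc 1 z) (fun T => ∏ p ∈ T, p) (fun T hT => ?_) ?_).trans
    (by simp)
  · have := mem_primeSets.1 hT
    exact mem_coe.2 (mem_Icc.2 ⟨prod_pos fun p hp => (this.1 p hp).pos, this.2⟩)
  · intro S hS T hT h
    have h1 := Nat.primeFactors_prod (mem_primeSets.1 hS).1
    have h2 := Nat.primeFactors_prod (mem_primeSets.1 hT).1
    rw [← h1, ← h2]
    exact congrArg _ h

theorem exists_sum_pow_card_le (δ : ℝ) (hδ : 0 < δ) :
    ∃ C : ℝ, 0 < C ∧ ∀ z : ℕ, 1 ≤ z →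
      ∑ T ∈ primeSets z, (6 : ℝ) ^ #T ≤ C * (z : ℝ) ^ (1 + δ) := by
  obtain ⟨C, hC, h⟩ := exists_pow_card_le_mul_rpow 6 (by norm_num) δ hδ
  refine ⟨C, hC, fun z hz => ?_⟩
  have h1 : ∀ T ∈ primeSets z, (6 : ℝ) ^ #T ≤ C * (z : ℝ) ^ δ := by
    intro T hT
    have hT := mem_primeSets.1 hT
    refine (h T hT.1).trans (mul_le_mul_of_nonneg_left ?_ hC.le)
    exact Real.rpow_le_rpow (by positivity) (by exact_mod_cast hT.2) hδ.le
  refine (sum_le_sum h1).trans ?_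
  have hz0 : (0 : ℝ) < z := by exact_mod_cast hz
  rw [sum_const, nsmul_eq_mul, Real.rpow_add hz0, Real.rpow_one]
  have : (#(primeSets z) : ℝ) ≤ z := by exact_mod_cast card_primeSets_le z
  calc _ ≤ z * (C * (z : ℝ) ^ δ) := mul_le_mul_of_nonneg_right this (by positivity)
    _ = _ := by ring

/-! ### Mean square of the singular factor. -/

theorem sum_sub_sq_multiples_le (N m : ℕ) (hm : 0 < m) :
    ∑ h ∈ Icc 1 N with m ∣ h, ((N : ℝ) - h) ^ 2 ≤ (N : ℝ) ^ 3 / (3 * m) := by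
  have hm0 : (0 : ℝ) < m := by exact_mod_cast hm
  have h1 : ∀ J : ℕ, m * J ≤ N → ∑ j ∈ Icc 1 J, ((N : ℝ) - (m * j : ℕ)) ^ 2 ≤
      ((N : ℝ) ^ 3 - (N - m * J) ^ 3) / (3 * m) := by
    intro J
    induction J with
    | zero => intro _; simp
    | succ J ih =>
      intro hJ
      rw [sum_Icc_succ_top (by omega)]
      have ih := ih (le_trans (Nat.mul_le_mul_left m (Nat.le_succ J)) hJ)
      have hJ' : (m : ℝ) * (J + 1) ≤ N := by exact_mod_cast hJ
      rw [le_div_iff₀ (by positivity)] at ih ⊢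
      push_cast at ih ⊢
      have hb : 0 ≤ (N : ℝ) - m * (J + 1) := by linarith
      have e : (N : ℝ) - m * J = (N - m * (J + 1)) + m := by ring
      rw [e] at ih
      generalize (N : ℝ) - m * (J + 1) = b at *
      rw [add_mul]
      have h3 : 0 ≤ 3 * b * (m : ℝ) ^ 2 := by positivity
      have h4 : 0 ≤ (m : ℝ) ^ 3 := by positivity
      nlinarith
  have h2 : {h ∈ Icc 1 N | m ∣ h} ⊆ (Icc 1 (N / m)).image (m * ·) := by
    intro h hh
    rw [mem_filter, mem_Icc] at hh
    obtain ⟨⟨h1, hN⟩, j, rfl⟩ := hh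
    refine mem_image.2 ⟨j, mem_Icc.2 ⟨Nat.pos_of_mul_pos_left h1, ?_⟩, rfl⟩
    rw [Nat.le_div_iff_mul_le hm, mul_comm]
    exact hN
  refine (sum_le_sum_of_subset_of_nonneg h2 fun _ _ _ => sq_nonneg _).trans ?_
  rw [sum_image fun a _ b _ h => Nat.eq_of_mul_eq_mul_left hm h]
  have hle : m * (N / m) ≤ N := Nat.mul_div_le N m
  refine (h1 _ hle).trans (div_le_div_of_nonneg_right ?_ (by positivity))
  have : (m : ℝ) * (N / m : ℕ) ≤ N := by exact_mod_cast hle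
  have : 0 ≤ ((N : ℝ) - m * (N / m : ℕ)) ^ 3 := pow_nonneg (by linarith) 3
  linarith

/-- The value at an odd prime `p` of the Dirichlet convolution of the square of `singularFactor`
with the Möbius function. -/
noncomputable def singularSqCoeff (p : ℕ) : ℝ := 2 / ((p : ℝ) - 2) + 1 / ((p : ℝ) - 2) ^ 2

theorem singularFactor_sq (h : ℕ) :
    singularFactor h ^ 2 = ∑ T ∈ (h.primeFactors.erase 2).powerset, ∏ p ∈ T, singularSqCoeff p := by
  rw [← prod_one_add, singularFactor, ← prod_pow]
  refine prod_congr rfl fun p _ => ?_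
  rw [singularSqCoeff, ← one_div_pow]
  ring

theorem singularSqCoeff_nonneg {p : ℕ} (hp : 3 ≤ p) : 0 ≤ singularSqCoeff p := by
  have : (3 : ℝ) ≤ p := by exact_mod_cast hp
  have : 0 < (p : ℝ) - 2 := by linarith
  rw [singularSqCoeff]
  positivity

theorem sum_telescoping_le_half (K : ℕ) :
    ∑ j ∈ range K, (1 / (2 * (j : ℝ) + 2) - 1 / (2 * (j : ℝ) + 4)) ≤ 1 / 2 := by
  have h := sum_range_sub' (fun j : ℕ => 1 / (2 * (j : ℝ) + 2)) K
  have e : ∀ j : ℕ, 1 / (2 * (j : ℝ) + 4) = 1 / (2 * ((j + 1 : ℕ) : ℝ) + 2) := by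
    intro j; push_cast; ring
  simp_rw [e]
  rw [h]
  have : 0 ≤ 1 / (2 * (K : ℝ) + 2) := by positivity
  norm_num at this ⊢
  linarith

theorem prod_one_add_singularSqCoeff_div_le (Q : Finset ℕ) (hQ : ∀ p ∈ Q, Odd p ∧ 3 ≤ p) :
    ∏ p ∈ Q, (1 + singularSqCoeff p / p) ≤ 4 := by
  have hnn : ∀ p ∈ Q, 0 ≤ singularSqCoeff p / p := fun p hp =>
    div_nonneg (singularSqCoeff_nonneg (hQ p hp).2) (by positivity)
  have h5 : ∀ p ∈ Q.erase 3, Odd p ∧ 5 ≤ p := by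
    intro p hp
    rw [mem_erase] at hp
    obtain ⟨k, hk⟩ := (hQ p hp.2).1
    have := (hQ p hp.2).2
    exact ⟨⟨k, hk⟩, by omega⟩
  have hbound : ∀ p : ℕ, 5 ≤ p → singularSqCoeff p / p ≤ 1 / ((p : ℝ) - 3) - 1 / ((p : ℝ) - 1) := by
    intro p hp
    have hp' : (5 : ℝ) ≤ p := by exact_mod_cast hp
    have e : 1 / ((p : ℝ) - 3) - 1 / ((p : ℝ) - 1) = 2 / (((p : ℝ) - 3) * (p - 1)) := by
      have h1 : (p : ℝ) - 3 ≠ 0 := by linarith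
      have h2 : (p : ℝ) - 1 ≠ 0 := by linarith
      field_simp
      ring
    have e2 : singularSqCoeff p / p = (2 * p - 3) / (p * (p - 2) ^ 2) := by
      have h1 : (p : ℝ) - 2 ≠ 0 := by linarith
      have h2 : (p : ℝ) ≠ 0 := by linarith
      rw [singularSqCoeff]
      field_simp
      ring
    have h3 : (0 : ℝ) < p - 3 := by linarith
    have h4 : (0 : ℝ) < p - 1 := by linarith
    have h6 : (0 : ℝ) < p - 2 := by linarith
    have h7 : (0 : ℝ) < p := by linarith
    rw [e, e2, div_le_div_iff₀ (by positivity) (by positivity)]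
    nlinarith [mul_pos h3 h4]
  -- Enlarging from Q to all odd numbers p = 2j + 5 makes the bound telescope.
  have hsum : ∑ p ∈ Q.erase 3, singularSqCoeff p / p ≤ 1 / 2 := by
    refine (sum_le_sum fun p hp => hbound p (h5 p hp).2).trans ?_
    have hsub : Q.erase 3 ⊆ (range (Q.sup id)).image (fun j => 2 * j + 5) := by
      intro p hp
      obtain ⟨⟨k, hk⟩, hp5⟩ := h5 p hp
      have hle : p ≤ Q.sup id := le_sup (f := id) (mem_erase.1 hp).2
      exact mem_image.2 ⟨k - 2, mem_range.2 (by omega), by omega⟩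
    refine (sum_le_sum_of_subset_of_nonneg hsub fun p hp _ => ?_).trans ?_
    · obtain ⟨j, _, rfl⟩ := mem_image.1 hp
      rw [sub_nonneg]
      push_cast
      exact one_div_le_one_div_of_le (by linarith [(Nat.cast_nonneg j : (0 : ℝ) ≤ j)])
        (by linarith)
    · rw [sum_image fun a _ b _ h => by simpa using h]
      refine le_trans (le_of_eq (sum_congr rfl fun j _ => ?_)) (sum_telescoping_le_half (Q.sup id))
      push_cast
      congr 2 <;> ring
  have hprod : ∏ p ∈ Q.erase 3, (1 + singularSqCoeff p / p) ≤ 2 := by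
    have h1 : ∏ p ∈ Q.erase 3, (1 + singularSqCoeff p / p) ≤
        ∏ p ∈ Q.erase 3, Real.exp (singularSqCoeff p / p) :=
      prod_le_prod (fun p hp => by linarith [hnn p (mem_erase.1 hp).2])
        (fun p _ => by linarith [Real.add_one_le_exp (singularSqCoeff p / p)])
    rw [← Real.exp_sum] at h1
    refine h1.trans ((Real.exp_le_exp.2 hsum).trans ?_)
    have h2 : Real.exp (1 / 2) ^ 2 ≤ 2 ^ 2 := by
      rw [← Real.exp_nat_mul]
      norm_num
      linarith [Real.exp_one_lt_d9]
    exact le_of_sq_le_sq h2 (by norm_num)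
  by_cases h3 : 3 ∈ Q
  · rw [← mul_prod_erase Q _ h3]
    -- The prime 3 contributes exactly 2, and all others at most exp(1/2) ≤ 2, whence 4.
    have : 1 + singularSqCoeff 3 / (3 : ℕ) = 2 := by
      rw [singularSqCoeff]; norm_num
    rw [this]
    linarith
  · rw [erase_eq_of_notMem h3] at hprod
    linarith

theorem sum_sub_sq_mul_singularFactor_sq_le (N : ℕ) :
    ∑ h ∈ Icc 1 N with Even h, (((N : ℝ) - h) * singularFactor h) ^ 2 ≤ 2 / 3 * (N : ℝ) ^ 3 := by
  set Q := ((range (N + 1)).filter Nat.Prime).erase 2 with hQdef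
  have hQ : ∀ p ∈ Q, p.Prime ∧ Odd p ∧ 3 ≤ p := by
    intro p hp
    rw [hQdef, mem_erase, mem_filter] at hp
    have := hp.2.2.two_le
    exact ⟨hp.2.2, hp.2.2.odd_of_ne_two hp.1, by have := hp.1; omega⟩
  have hnn : ∀ T ∈ Q.powerset, 0 ≤ ∏ p ∈ T, singularSqCoeff p := fun T hT =>
    prod_nonneg fun p hp => singularSqCoeff_nonneg (hQ p (mem_powerset.1 hT hp)).2.2
  have h1 : ∀ h ∈ {h ∈ Icc 1 N | Even h}, (((N : ℝ) - h) * singularFactor h) ^ 2 ≤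
      ∑ T ∈ Q.powerset,
        if 2 * ∏ p ∈ T, p ∣ h then ((N : ℝ) - h) ^ 2 * ∏ p ∈ T, singularSqCoeff p else 0 := by
    intro h hh
    rw [mem_filter, mem_Icc] at hh
    rw [mul_pow, singularFactor_sq, mul_sum, ← sum_filter]
    refine sum_le_sum_of_subset_of_nonneg ?_ fun T hT _ =>
      mul_nonneg (sq_nonneg _) (hnn T (mem_filter.1 hT).1)
    intro T hT
    rw [mem_powerset] at hT
    have hTp : ∀ p ∈ T, p.Prime ∧ p ∣ h ∧ p ≠ 2 := fun p hp => by
      have := mem_erase.1 (hT hp)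
      exact ⟨Nat.prime_of_mem_primeFactors this.2, Nat.dvd_of_mem_primeFactors this.2, this.1⟩
    rw [mem_filter, mem_powerset]
    refine ⟨fun p hp => ?_, ?_⟩
    · have hp' := hTp p hp
      have := Nat.le_of_dvd (by omega) hp'.2.1
      exact mem_erase.2 ⟨hp'.2.2, mem_filter.2 ⟨mem_range.2 (by omega), hp'.1⟩⟩
    · refine Nat.Coprime.mul_dvd_of_dvd_of_dvd ?_ hh.2.two_dvd ?_
      · exact Nat.Coprime.prod_right fun p hp =>
          (Nat.coprime_primes Nat.prime_two (hTp p hp).1).2 (hTp p hp).2.2.symm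
      · exact (prod_dvd_prod_of_subset _ _ _ fun p hp =>
          (mem_erase.1 (hT hp)).2).trans (Nat.prod_primeFactors_dvd h)
  refine (sum_le_sum h1).trans ?_
  rw [sum_comm]
  -- Evenness of h doubles the modulus, so the constant is 1/(3·2) = 1/6; the Euler product bound 4
  -- turns it into 2/3.
  have h2 : ∀ T ∈ Q.powerset, (∑ h ∈ Icc 1 N with Even h,
      if 2 * ∏ p ∈ T, p ∣ h then ((N : ℝ) - h) ^ 2 * ∏ p ∈ T, singularSqCoeff p else 0) ≤
      (N : ℝ) ^ 3 / 6 * ∏ p ∈ T, singularSqCoeff p / p := by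
    intro T hT
    have hT' := mem_powerset.1 hT
    have hpos : 0 < ∏ p ∈ T, p := prod_pos fun p hp => (hQ p (hT' hp)).1.pos
    have h3 := sum_sub_sq_multiples_le N (2 * ∏ p ∈ T, p) (by omega)
    rw [← sum_filter, ← sum_mul, filter_filter]
    refine (mul_le_mul_of_nonneg_right ((sum_le_sum_of_subset_of_nonneg ?_
      fun _ _ _ => sq_nonneg _).trans h3) (hnn T hT)).trans (le_of_eq ?_)
    · intro h hh
      rw [mem_filter] at hh ⊢
      exact ⟨hh.1, hh.2.2⟩
    · rw [prod_div_distrib]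
      push_cast
      have : (∏ p ∈ T, (p : ℝ)) ≠ 0 :=
        prod_ne_zero_iff.2 fun p hp => by exact_mod_cast (hQ p (hT' hp)).1.ne_zero
      field_simp
      ring
  refine (sum_le_sum h2).trans ?_
  rw [← mul_sum, ← prod_one_add]
  have h4 := prod_one_add_singularSqCoeff_div_le Q fun p hp => (hQ p hp).2
  have : (0 : ℝ) ≤ (N : ℝ) ^ 3 / 6 := by positivity
  nlinarith

/-! ### Cauchy–Schwarz and the additive energy of two sets of primes. -/

theorem sq_card_mul_card_le_card_image_sub_mul (A B : Finset ℕ) {a N : ℕ}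
    (hA : A ⊆ Ioc a (a + N)) :
    (#A * #B) ^ 2 ≤ #((A ×ˢ B).image fun x => (x.1 : ℤ) - x.2) *
      (#A * #B + 2 * ∑ h ∈ Icc 1 N, #{q ∈ A | q + h ∈ A} * #{q ∈ B | q + h ∈ B}) := by
  set f : ℕ × ℕ → ℤ := fun x => (x.1 : ℤ) - x.2 with hf
  set E : Finset ((ℕ × ℕ) × (ℕ × ℕ)) := {x ∈ (A ×ˢ B) ×ˢ (A ×ˢ B) | f x.1 = f x.2} with hE
  have h1 : ∑ d ∈ (A ×ˢ B).image f, #{x ∈ A ×ˢ B | f x = d} ^ 2 = #E := by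
    have hE' : #E = ∑ d ∈ (A ×ˢ B).image f, #{x ∈ E | f x.1 = d} :=
      card_eq_sum_card_fiberwise fun x hx =>
        mem_coe.2 (mem_image_of_mem f (mem_product.1 (mem_filter.1 hx).1).1)
    rw [hE']
    refine sum_congr rfl fun d _ => ?_
    rw [sq, ← card_product]
    congr 1
    ext ⟨x, y⟩
    simp only [hE, mem_filter, mem_product]
    constructor
    · rintro ⟨⟨h1, h2⟩, h3, h4⟩
      exact ⟨⟨⟨h1, h3⟩, h2.trans h4.symm⟩, h2⟩
    · rintro ⟨⟨⟨h1, h2⟩, h3⟩, h4⟩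
      exact ⟨⟨h1, h4⟩, h2, h3.symm.trans h4⟩
  have h2 : #A * #B = ∑ d ∈ (A ×ˢ B).image f, #{x ∈ A ×ˢ B | f x = d} := by
    rw [← card_product]
    exact card_eq_sum_card_fiberwise fun x hx => mem_coe.2 (mem_image_of_mem f hx)
  have h3 : (#A * #B) ^ 2 ≤ #((A ×ˢ B).image f) * #E := by
    rw [← h1, h2]
    exact sq_sum_le_card_mul_sum_sq
  refine h3.trans (Nat.mul_le_mul_left _ ?_)
  -- U holds the quadruples with positive common shift h; swapping the pairs gives negative shifts,
  -- hence the factor 2.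
  set U := (Icc 1 N).biUnion fun h =>
    ({q ∈ A | q + h ∈ A} ×ˢ {q ∈ B | q + h ∈ B}).image
      fun x : ℕ × ℕ => (x, (x.1 + h, x.2 + h)) with hU
  have hUc : #U ≤ ∑ h ∈ Icc 1 N, #{q ∈ A | q + h ∈ A} * #{q ∈ B | q + h ∈ B} := by
    refine card_biUnion_le.trans (sum_le_sum fun h _ => ?_)
    rw [← card_product]
    exact card_image_le
  have hUmem : ∀ p q p' q' : ℕ, p ∈ A → q ∈ B → p' ∈ A → q' ∈ B → (p : ℤ) - q = p' - q' →
      p < p' → ((p, q), (p', q')) ∈ U := by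
    intro p q p' q' hp hq hp' hq' he hlt
    have hpa := mem_Ioc.1 (hA hp)
    have hpa' := mem_Ioc.1 (hA hp')
    have e1 : p + (p' - p) = p' := by omega
    have e2 : q + (p' - p) = q' := by omega
    refine mem_biUnion.2 ⟨p' - p, mem_Icc.2 (by omega), mem_image.2 ⟨(p, q), ?_, by rw [e1, e2]⟩⟩
    rw [mem_product, mem_filter, mem_filter, e1, e2]
    exact ⟨⟨hp, hp'⟩, hq, hq'⟩
  have hsub : E ⊆ (A ×ˢ B).image (fun x => (x, x)) ∪ (U ∪ U.image Prod.swap) := by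
    rintro ⟨⟨p, q⟩, ⟨p', q'⟩⟩ hx
    simp only [hE, mem_filter, mem_product, hf] at hx
    obtain ⟨⟨⟨hp, hq⟩, hp', hq'⟩, he⟩ := hx
    rw [mem_union, mem_union]
    rcases lt_trichotomy p p' with hlt | heq | hlt
    · exact Or.inr (Or.inl (hUmem p q p' q' hp hq hp' hq' he hlt))
    · have hqq : q = q' := by omega
      subst heq hqq
      exact Or.inl (mem_image.2 ⟨(p, q), mem_product.2 ⟨hp, hq⟩, rfl⟩)
    · exact Or.inr (Or.inr (mem_image.2
        ⟨((p', q'), (p, q)), hUmem p' q' p q hp' hq' hp hq he.symm hlt, rfl⟩))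
  have h4 := card_le_card hsub
  have h5 := card_union_le ((A ×ˢ B).image fun x => (x, x)) (U ∪ U.image Prod.swap)
  have h6 := card_union_le U (U.image Prod.swap)
  have h7 : #(U.image Prod.swap) ≤ #U := card_image_le
  have h8 : #((A ×ˢ B).image fun x => (x, x)) ≤ #A * #B := by
    rw [← card_product]; exact card_image_le
  omega

/-- If q and q + h both lie in the window, q lies in its initial part of length N - h; this is the
source of the weight N - h. -/
theorem card_filter_add_mem_le {A : Finset ℕ} {a N h z : ℕ} (hA : A ⊆ Ioc a (a + N))
    (hp : ∀ p ∈ A, p.Prime) (hz : 1 ≤ z) (hza : z ≤ a) (hh : h ∈ Icc 1 N) (h2 : Even h) :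
    (#{q ∈ A | q + h ∈ A} : ℝ) ≤
      ((N : ℝ) - h) * singularFactor h / twinSum z + (∑ T ∈ primeSets z, (6 : ℝ) ^ #T) ^ 2 := by
  rw [mem_Icc] at hh
  have key := card_prime_pairs_le (a := a) (L := N - h) hz hza (by omega) h2
  rw [Nat.cast_sub hh.2] at key
  refine le_trans ?_ key
  refine Nat.cast_le.2 (card_le_card fun q hq => ?_)
  rw [mem_filter] at hq
  have h3 := mem_Ioc.1 (hA hq.1)
  have h4 := mem_Ioc.1 (hA hq.2)
  exact mem_filter.2 ⟨mem_Ioc.2 (by omega), hp _ hq.1, hp _ hq.2⟩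

theorem card_filter_add_mem_of_odd {A : Finset ℕ} {h : ℕ} (hA : ∀ p ∈ A, p.Prime ∧ 2 < p)
    (h2 : ¬ Even h) : #{q ∈ A | q + h ∈ A} = 0 := by
  rw [card_eq_zero, filter_eq_empty_iff]
  intro q hq hqh
  have h3 := (hA q hq).1.odd_of_ne_two (hA q hq).2.ne'
  have h4 := (hA _ hqh).1.odd_of_ne_two (hA _ hqh).2.ne'
  rw [Nat.not_even_iff_odd] at h2
  exact (Nat.not_even_iff_odd.2 h4) (h3.add_odd h2)

theorem sum_card_shift_mul_card_shift_le {A B : Finset ℕ} {a b N z : ℕ}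
    (hA : A ⊆ Ioc a (a + N)) (hB : B ⊆ Ioc b (b + N)) (hAp : ∀ p ∈ A, p.Prime)
    (hBp : ∀ p ∈ B, p.Prime) (hz : 1 ≤ z) (hza : z ≤ a) (hzb : z ≤ b) (ha : 2 ≤ a) :
    ∑ h ∈ Icc 1 N, (#{q ∈ A | q + h ∈ A} : ℝ) * #{q ∈ B | q + h ∈ B} ≤
      11 / 15 * (N : ℝ) ^ 3 / twinSum z ^ 2 +
        11 * N * (∑ T ∈ primeSets z, (6 : ℝ) ^ #T) ^ 4 := by
  set F := ∑ T ∈ primeSets z, (6 : ℝ) ^ #T with hF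
  have h1 : ∀ h ∈ Icc 1 N, (#{q ∈ A | q + h ∈ A} : ℝ) * #{q ∈ B | q + h ∈ B} ≤
      (if Even h then 11 / 10 / twinSum z ^ 2 * (((N : ℝ) - h) * singularFactor h) ^ 2 else 0) +
        11 * F ^ 4 := by
    intro h hh
    split_ifs with h2
    · have hA' := card_filter_add_mem_le hA hAp hz hza hh h2
      have hB' := card_filter_add_mem_le hB hBp hz hzb hh h2
      rw [← hF] at hA' hB'
      have e : 11 / 10 / twinSum z ^ 2 * (((N : ℝ) - h) * singularFactor h) ^ 2 =
          11 / 10 * (((N : ℝ) - h) * singularFactor h / twinSum z) ^ 2 := by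
        rw [div_pow]; ring
      rw [e]
      generalize ((N : ℝ) - h) * singularFactor h / twinSum z = u at *
      have h3 := mul_le_mul hA' hB' (by positivity) (le_trans (by positivity) hA')
      -- (u + F²)² ≤ (11/10) u² + 11 F⁴, the cross term being split as 2uF² ≤ u²/10 + 10F⁴. Then
      -- 11/15 = (11/10)(2/3).
      nlinarith [sq_nonneg (u - 10 * F ^ 2)]
    · rw [card_filter_add_mem_of_odd (fun p hp => ⟨hAp p hp, by
        have := mem_Ioc.1 (hA hp); omega⟩) h2]
      simp only [Nat.cast_zero, zero_mul, zero_add]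
      positivity
  refine (sum_le_sum h1).trans ?_
  rw [sum_add_distrib, ← sum_filter, ← mul_sum, sum_const, Nat.card_Icc, nsmul_eq_mul,
    Nat.add_sub_cancel]
  have h4 := mul_le_mul_of_nonneg_left (sum_sub_sq_mul_singularFactor_sq_le N)
    (by positivity : 0 ≤ 11 / 10 / twinSum z ^ 2)
  have e : 11 / 10 / twinSum z ^ 2 * (2 / 3 * (N : ℝ) ^ 3) =
      11 / 15 * (N : ℝ) ^ 3 / twinSum z ^ 2 := by ring
  rw [e] at h4
  linarith

/-- Absorbs the diagonal and the sieve error, both a power of N below N³. The 27 is what 600 leaves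
after 2 · 286.5. -/
theorem eventually_log_pow_mul_le (C : ℝ) (hC : 0 ≤ C) :
    ∀ᶠ N : ℕ in Filter.atTop,
      Real.log N ^ 4 * ((N : ℝ) ^ 2 + C * (N : ℝ) ^ (2.89 : ℝ)) ≤ 27 * (N : ℝ) ^ 3 := by
  have h1 := ((isLittleO_log_rpow_atTop (by norm_num : (0 : ℝ) < 0.025)).comp_tendsto
    tendsto_natCast_atTop_atTop).def (by positivity : (0 : ℝ) < 1 / (1 + C))
  filter_upwards [h1, Filter.eventually_ge_atTop 1] with N h hN
  have hN1 : (1 : ℝ) ≤ N := by exact_mod_cast hN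
  have hN0 : (0 : ℝ) < N := by linarith
  have hlog : 0 ≤ Real.log N := Real.log_nonneg hN1
  simp only [Function.comp_apply] at h
  rw [Real.norm_of_nonneg hlog, Real.norm_of_nonneg (by positivity)] at h
  have h2 : Real.log N ^ 4 ≤ 1 / (1 + C) * (N : ℝ) ^ (0.1 : ℝ) := by
    refine (pow_le_pow_left₀ hlog h 4).trans ?_
    rw [mul_pow, ← Real.rpow_natCast ((N : ℝ) ^ (0.025 : ℝ)), ← Real.rpow_mul hN0.le]
    have h3 : (1 / (1 + C)) ^ 4 ≤ 1 / (1 + C) :=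
      pow_le_of_le_one (by positivity) ((div_le_one (by positivity)).2 (by linarith)) (by norm_num)
    have e : (0.025 : ℝ) * (4 : ℕ) = 0.1 := by norm_num
    rw [e]
    exact mul_le_mul_of_nonneg_right h3 (by positivity)
  have h3 : (N : ℝ) ^ 2 + C * (N : ℝ) ^ (2.89 : ℝ) ≤ (1 + C) * (N : ℝ) ^ (2.9 : ℝ) := by
    have h4 : (N : ℝ) ^ 2 ≤ (N : ℝ) ^ (2.9 : ℝ) := by
      rw [← Real.rpow_natCast]
      exact Real.rpow_le_rpow_of_exponent_le hN1 (by norm_num)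
    have h5 : (N : ℝ) ^ (2.89 : ℝ) ≤ (N : ℝ) ^ (2.9 : ℝ) :=
      Real.rpow_le_rpow_of_exponent_le hN1 (by norm_num)
    nlinarith
  calc _ ≤ (1 / (1 + C) * (N : ℝ) ^ (0.1 : ℝ)) * ((1 + C) * (N : ℝ) ^ (2.9 : ℝ)) :=
        mul_le_mul h2 h3 (by positivity) (by positivity)
    _ = (N : ℝ) ^ (0.1 : ℝ) * (N : ℝ) ^ (2.9 : ℝ) := by field_simp
    _ = (N : ℝ) ^ 3 := by
        rw [← Real.rpow_add hN0, ← Real.rpow_natCast]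
        norm_num
    _ ≤ 27 * (N : ℝ) ^ 3 := by
        have : 0 ≤ (N : ℝ) ^ 3 := by positivity
        linarith

/-- A set of differences of primes from two intervals of length `N` is large if there are many
primes in these intervals. -/
theorem eventually_sq_card_mul_card_mul_log_le :
    ∀ᶠ N : ℕ in Filter.atTop, ∀ a b : ℕ, N ≤ a → N ≤ b → ∀ A B : Finset ℕ,
      A ⊆ Ioc a (a + N) → B ⊆ Ioc b (b + N) → (∀ p ∈ A, p.Prime) → (∀ p ∈ B, p.Prime) →
      ((#A : ℝ) * #B) ^ 2 * Real.log N ^ 4 ≤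
        #((A ×ˢ B).image fun x => (x.1 : ℤ) - x.2) * (600 * (N : ℝ) ^ 3) := by
  obtain ⟨C, hC, hF⟩ := exists_sum_pow_card_le 0.05 (by norm_num)
  filter_upwards [eventually_log_pow_mul_le (22 * (C ^ 4 * 2 ^ (4.2 : ℝ))) (by positivity),
    Filter.eventually_ge_atTop 2] with N hlogN hN2 a b ha hb A B hA hB hAp hBp
  have hN1 : (1 : ℝ) < N := by exact_mod_cast (by omega : 1 < N)
  have hN0 : (0 : ℝ) < N := by linarith
  -- The error N F⁴ is of order N · z^4.2, that is N^2.89, below N³; the exponent of z has to stay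
  -- under 1/2.
  set z := ⌈(N : ℝ) ^ (0.45 : ℝ)⌉₊ with hzdef
  have hpow1 : (1 : ℝ) ≤ (N : ℝ) ^ (0.45 : ℝ) := Real.one_le_rpow hN1.le (by norm_num)
  have hzle : (N : ℝ) ^ (0.45 : ℝ) ≤ z := Nat.le_ceil _
  have hz1 : 1 ≤ z := by exact_mod_cast hpow1.trans hzle
  have hzN : z ≤ N := by
    refine Nat.ceil_le.2 ?_
    exact (Real.rpow_le_rpow_of_exponent_le hN1.le (by norm_num)).trans (Real.rpow_one _).le
  have hz2 : (z : ℝ) ≤ 2 * (N : ℝ) ^ (0.45 : ℝ) := by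
    have := (Nat.ceil_lt_add_one (le_trans zero_le_one hpow1)).le
    rw [← hzdef] at this
    linarith
  have hz0 : (0 : ℝ) < z := by exact_mod_cast hz1
  have hsum := sum_card_shift_mul_card_shift_le hA hB hAp hBp hz1 (hzN.trans ha) (hzN.trans hb)
    (hN2.trans ha)
  set F := ∑ T ∈ primeSets z, (6 : ℝ) ^ #T with hFdef
  have hlog0 : 0 < Real.log N := Real.log_pos hN1
  -- 0.050625 = 0.45² / 4, and (11/15) / 0.050625² < 286.5.
  have hW : 0.050625 * Real.log N ^ 2 ≤ twinSum z := by
    refine le_trans ?_ (log_sq_div_four_le_twinSum z hz1)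
    have h1 : 0.45 * Real.log N ≤ Real.log z := by
      rw [← Real.log_rpow hN0]
      exact Real.log_le_log (by positivity) hzle
    have := pow_le_pow_left₀ (by positivity) h1 2
    rw [mul_pow] at this
    linarith
  have hmain : 11 / 15 * (N : ℝ) ^ 3 / twinSum z ^ 2 * Real.log N ^ 4 ≤ 286.5 * (N : ℝ) ^ 3 := by
    have hW0 : 0 < twinSum z := lt_of_lt_of_le (by positivity) hW
    have h1 := pow_le_pow_left₀ (by positivity) hW 2
    rw [div_mul_eq_mul_div, div_le_iff₀ (by positivity)]
    have h2 : 11 / 15 * Real.log N ^ 4 ≤ 286.5 * twinSum z ^ 2 := by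
      have e : (0.050625 * Real.log N ^ 2) ^ 2 = 0.050625 ^ 2 * Real.log N ^ 4 := by ring
      rw [e] at h1
      have : 0 ≤ Real.log N ^ 4 := by positivity
      norm_num at h1 ⊢
      linarith
    have : 0 ≤ (N : ℝ) ^ 3 := by positivity
    nlinarith
  have hF4 : F ^ 4 ≤ C ^ 4 * 2 ^ (4.2 : ℝ) * (N : ℝ) ^ (1.89 : ℝ) := by
    have hF0 : 0 ≤ F := sum_nonneg fun T _ => by positivity
    refine (pow_le_pow_left₀ hF0 (hF z hz1) 4).trans ?_
    rw [mul_pow, mul_assoc]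
    refine mul_le_mul_of_nonneg_left ?_ (by positivity)
    rw [← Real.rpow_natCast, ← Real.rpow_mul hz0.le]
    have e : (1 + 0.05 : ℝ) * (4 : ℕ) = 4.2 := by norm_num
    rw [e]
    refine (Real.rpow_le_rpow hz0.le hz2 (by norm_num)).trans (le_of_eq ?_)
    rw [Real.mul_rpow (by norm_num) (by positivity), ← Real.rpow_mul hN0.le]
    norm_num
  have hAN : (#A : ℝ) ≤ N := by
    have := card_le_card hA
    rw [Nat.card_Ioc] at this
    exact_mod_cast (by omega : #A ≤ N)
  have hBN : (#B : ℝ) ≤ N := by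
    have := card_le_card hB
    rw [Nat.card_Ioc] at this
    exact_mod_cast (by omega : #B ≤ N)
  have hcs := sq_card_mul_card_le_card_image_sub_mul A B hA
  have hcs' : ((#A : ℝ) * #B) ^ 2 ≤ #((A ×ˢ B).image fun x => (x.1 : ℤ) - x.2) *
      (#A * #B + 2 * ∑ h ∈ Icc 1 N, (#{q ∈ A | q + h ∈ A} : ℝ) * #{q ∈ B | q + h ∈ B}) := by
    exact_mod_cast hcs
  set W := ∑ h ∈ Icc 1 N, (#{q ∈ A | q + h ∈ A} : ℝ) * #{q ∈ B | q + h ∈ B}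
  have hE : ((#A : ℝ) * #B + 2 * W) * Real.log N ^ 4 ≤ 600 * (N : ℝ) ^ 3 := by
    have hAB : (#A : ℝ) * #B ≤ (N : ℝ) ^ 2 := by
      rw [sq]; exact mul_le_mul hAN hBN (by positivity) hN0.le
    have e : (N : ℝ) * (N : ℝ) ^ (1.89 : ℝ) = (N : ℝ) ^ (2.89 : ℝ) := by
      nth_rewrite 1 [← Real.rpow_one (N : ℝ)]
      rw [← Real.rpow_add hN0]
      norm_num
    have hNF : 22 * N * F ^ 4 ≤ 22 * (C ^ 4 * 2 ^ (4.2 : ℝ)) * (N : ℝ) ^ (2.89 : ℝ) := by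
      rw [← e]
      have := mul_le_mul_of_nonneg_left hF4 hN0.le
      linarith
    have hle : (#A : ℝ) * #B + 2 * W ≤ 2 * (11 / 15 * (N : ℝ) ^ 3 / twinSum z ^ 2) +
        ((N : ℝ) ^ 2 + 22 * (C ^ 4 * 2 ^ (4.2 : ℝ)) * (N : ℝ) ^ (2.89 : ℝ)) := by
      linarith
    have := mul_le_mul_of_nonneg_right hle (by positivity : 0 ≤ Real.log N ^ 4)
    linarith
  calc _ ≤ _ := mul_le_mul_of_nonneg_right hcs' (by positivity)
    _ = #((A ×ˢ B).image fun x => (x.1 : ℤ) - x.2) *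
        (((#A : ℝ) * #B + 2 * W) * Real.log N ^ 4) := by ring
    _ ≤ _ := mul_le_mul_of_nonneg_left hE (by positivity)

/-! ### Passage to real intervals. -/

theorem card_primes_Ioc_floor {u v : ℝ} (huv : u ≤ v) :
    (#{p ∈ Ioc ⌊u⌋₊ ⌊v⌋₊ | p.Prime} : ℝ) = (primePi v : ℝ) - primePi u := by
  have h : primePi v = primePi u + #{p ∈ Ioc ⌊u⌋₊ ⌊v⌋₊ | p.Prime} := by
    rw [primePi, primePi, Nat.primeCounting, Nat.primeCounting, Nat.primeCounting',
      Nat.count_eq_card_filter_range, Nat.count_eq_card_filter_range, ← card_union_of_disjoint,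
      ← filter_union]
    · congr 2
      ext n
      have := Nat.floor_mono huv
      simp only [mem_range, mem_union, mem_Ioc]
      omega
    · refine disjoint_filter_filter (disjoint_left.2 fun n hn hn' => ?_)
      rw [mem_range] at hn
      rw [mem_Ioc] at hn'
      omega
  rw [h]
  push_cast
  ring

theorem proposition3p1 (α : ℝ) (hα₀ : 0 < α) (hα₁ : α < 1) :
    ∃ x₀ : ℝ, ∀ x : ℝ, x₀ ≤ x → ∀ ε : ℝ, ε ≤ 1 →
      (1 - ε) * x ^ α / Real.log x ≤ (primePi (x + x ^ α) : ℝ) - (primePi x : ℝ) →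
      (1 - ε) * x ^ α / Real.log x ≤ (primePi x : ℝ) - (primePi (x - x ^ α) : ℝ) →
      (0.00164 : ℝ) * α ^ 4 * (1 - ε) ^ 4 * x ^ α ≤ ((primeDiffSet x α).ncard : ℝ) := by
  have hy := tendsto_rpow_atTop hα₀
  have hfloor := (tendsto_nat_floor_atTop (α := ℝ)).comp hy
  -- A half-open real interval of length y can contain ⌊y⌋ + 1 integers. Below, y ≥ 1000 makes this
  -- at most 1.001 y, and x^(1-α) ≥ 4 gives x - y ≥ 3y, so both windows start beyond N.
  have hN : Filter.Tendsto (fun x : ℝ => ⌊x ^ α⌋₊ + 1) Filter.atTop Filter.atTop :=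
    (Filter.tendsto_add_atTop_nat 1).comp hfloor
  have hev := (hN.eventually eventually_sq_card_mul_card_mul_log_le).and
    ((hy.eventually_ge_atTop 1000).and (((tendsto_rpow_atTop
      (sub_pos.2 hα₁)).eventually_ge_atTop 4).and (Filter.eventually_gt_atTop (1 : ℝ))))
  obtain ⟨x₀, hx₀⟩ := hev.exists_forall_of_atTop
  refine ⟨x₀, fun x hx ε hε hA hB => ?_⟩
  obtain ⟨key, hy1000, hx4, hx1⟩ := hx₀ x hx
  have hx0 : 0 < x := by linarith
  have hxy : x = x ^ α * x ^ (1 - α) := by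
    rw [← Real.rpow_add hx0]; simp
  have hlogy : Real.log (x ^ α) = α * Real.log x := Real.log_rpow hx0 α
  set y := x ^ α with hydef
  have hy0 : 0 < y := by linarith
  have hxy4 : 4 * y ≤ x := by
    have := mul_le_mul_of_nonneg_left hx4 hy0.le
    linarith
  have hylt := Nat.lt_floor_add_one y
  have hyle := Nat.floor_le hy0.le
  have hxlt := Nat.lt_floor_add_one x
  have hxle := Nat.floor_le hx0.le
  have hxmlt := Nat.lt_floor_add_one (x - y)
  have hxmle := Nat.floor_le (by linarith : 0 ≤ x - y)
  have hxple := Nat.floor_le (by linarith : 0 ≤ x + y)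
  set A : Finset ℕ := {p ∈ Ioc ⌊x⌋₊ ⌊x + y⌋₊ | p.Prime} with hAdef
  set B : Finset ℕ := {p ∈ Ioc ⌊x - y⌋₊ ⌊x⌋₊ | p.Prime} with hBdef
  have hcA : (#A : ℝ) = primePi (x + y) - primePi x := card_primes_Ioc_floor (by linarith)
  have hcB : (#B : ℝ) = primePi x - primePi (x - y) := card_primes_Ioc_floor (by linarith)
  rw [← hcA] at hA
  rw [← hcB] at hB
  have hNb : ⌊y⌋₊ + 1 ≤ ⌊x - y⌋₊ := by
    apply Nat.le_floor
    push_cast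
    linarith
  have hba : ⌊x - y⌋₊ ≤ ⌊x⌋₊ := Nat.floor_mono (by linarith)
  have hA1 : ⌊x + y⌋₊ ≤ ⌊x⌋₊ + (⌊y⌋₊ + 1) := by
    have : (⌊x + y⌋₊ : ℝ) < (⌊x⌋₊ + (⌊y⌋₊ + 1) + 1 : ℕ) := by push_cast; linarith
    have : ⌊x + y⌋₊ < ⌊x⌋₊ + (⌊y⌋₊ + 1) + 1 := by exact_mod_cast this
    omega
  have hB1 : ⌊x⌋₊ ≤ ⌊x - y⌋₊ + (⌊y⌋₊ + 1) := by
    have : (⌊x⌋₊ : ℝ) < (⌊x - y⌋₊ + (⌊y⌋₊ + 1) + 1 : ℕ) := by push_cast; linarith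
    have : ⌊x⌋₊ < ⌊x - y⌋₊ + (⌊y⌋₊ + 1) + 1 := by exact_mod_cast this
    omega
  have hkey := key ⌊x⌋₊ ⌊x - y⌋₊ (hNb.trans hba) hNb A B
    ((filter_subset _ _).trans (Ioc_subset_Ioc_right hA1))
    ((filter_subset _ _).trans (Ioc_subset_Ioc_right hB1))
    (fun p hp => (mem_filter.1 hp).2) (fun p hp => (mem_filter.1 hp).2)
  have himg : (#((A ×ˢ B).image fun x => (x.1 : ℤ) - x.2) : ℝ) ≤ (primeDiffSet x α).ncard := by
    rw [← Set.ncard_coe_finset]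
    refine Nat.cast_le.2 (Set.ncard_le_ncard (fun d hd => ?_) (primeDiffSet_finite x α))
    obtain ⟨⟨P, Q⟩, hPQ, rfl⟩ := mem_image.1 (mem_coe.1 hd)
    rw [mem_product, hAdef, hBdef, mem_filter, mem_filter, mem_Ioc, mem_Ioc] at hPQ
    obtain ⟨⟨⟨hP1, hP2⟩, hP⟩, ⟨hQ1, hQ2⟩, hQ⟩ := hPQ
    exact ⟨P, Q, hP, hQ, (Nat.floor_lt (by linarith)).1 hQ1,
      (Nat.le_floor_iff hx0.le).1 hQ2, (Nat.floor_lt hx0.le).1 hP1,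
      (Nat.le_floor_iff (by linarith)).1 hP2, rfl⟩
  set M : ℝ := ((primeDiffSet x α).ncard : ℝ) with hM
  have hM0 : 0 ≤ M := by positivity
  have hlogx : 0 < Real.log x := Real.log_pos hx1
  have hδ : 0 ≤ 1 - ε := by linarith
  set N : ℝ := ((⌊y⌋₊ + 1 : ℕ) : ℝ) with hNdef
  have hNy : y ≤ N := by rw [hNdef]; push_cast; exact hylt.le
  have hNle : N ≤ 1.001 * y := by
    rw [hNdef]; push_cast; linarith
  have hlogN : α * Real.log x ≤ Real.log N := by
    rw [← hlogy]
    exact Real.log_le_log hy0 hNy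
  set S := (1 - ε) * y / Real.log x with hS
  have hS0 : 0 ≤ S := by positivity
  have h1 : (S * S) ^ 2 ≤ ((#A : ℝ) * #B) ^ 2 :=
    pow_le_pow_left₀ (by positivity) (mul_le_mul hA hB hS0 (Nat.cast_nonneg _)) 2
  have h2 : (α * Real.log x) ^ 4 ≤ Real.log N ^ 4 := pow_le_pow_left₀ (by positivity) hlogN 4
  have h3 : N ^ 3 ≤ (1.001 * y) ^ 3 := pow_le_pow_left₀ (by positivity) hNle 3
  have h4 : (S * S) ^ 2 * (α * Real.log x) ^ 4 ≤ M * (600 * (1.001 * y) ^ 3) := by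
    refine (mul_le_mul h1 h2 (by positivity) (sq_nonneg _)).trans (hkey.trans ?_)
    exact mul_le_mul himg (by linarith) (by positivity) hM0
  have h5 : (S * S) ^ 2 * (α * Real.log x) ^ 4 = (α ^ 4 * (1 - ε) ^ 4 * y) * y ^ 3 := by
    rw [hS]; field_simp
  have h6 : M * (600 * (1.001 * y) ^ 3) = (600 * 1.001 ^ 3 * M) * y ^ 3 := by ring
  rw [h5, h6] at h4
  have h7 := le_of_mul_le_mul_right h4 (by positivity)
  -- 1 / (600 · 1.001³) is about 0.00166, which exceeds 0.00164.
  norm_num at h7 ⊢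
  linarith
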